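/- Let $d\ge 1$, $\mu,h\in\mathbb{R}$, $\lambda,\gamma\ge 0$. For $L\in\mathbb{N}_0$ let $\Lambda_L=\{-L,\dots,L\}^d$, let $\mathcal{F}_{\Lambda_L}=\bigwedge\mathbb{C}^{\Lambda_L\times\{\uparrow,\downarrow\}}$ be the fermion Fock space with annihilation operators $a_{x,s}$ satisfying the canonical anticommutation relations, let $n_{x,s}=a_{x,s}^*a_{x,s}$, and let $$\mathrm{H}_L=\sum_{x\in\Lambda_L}\bigl(2\lambda n_{x,\uparrow}n_{x,\downarrow}-\mu(n_{x,\uparrow}+n_{x,\downarrow})-h(n_{x,\uparrow}-n_{x,\downarrow})\bigr)-\frac{\gamma}{|\Lambda_L|}\sum_{x,y\in\Lambda_L}a_{x,\uparrow}^*a_{x,\downarrow}^*a_{y,\downarrow}a_{y,\uparrow}$$ be the strong-coupling BCS-Hubbard Hamiltonian, with Heisenberg dynamics $\tau_t^{(L)}(A)=e^{it\mathrm{H}_L}Ae^{-it\mathrm{H}_L}$. Regard $\mathcal{B}(\mathcal{F}_{\Lambda_{L_0}})$ as a subalgebra of $\mathcal{B}(\mathcal{F}_{\Lambda_L})$ for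 $L_0\le L$, the generators $a_{x,s}$ being identified. Let $\rho$ be an even state on $\mathcal{B}(\mathcal{F}_{\{0\}})$ (that is, a state vanishing on all odd monomials in $a_{0,s},a_{0,s}^*$), and let $\otimes_{\Lambda_L}\rho$ be the corresponding product state on $\mathcal{B}(\mathcal{F}_{\Lambda_L})$. Then, for all $t\in\mathbb{R}$, $L_0\in\mathbb{N}_0$ and $A\in\mathcal{B}(\mathcal{F}_{\Lambda_{L_0}})$, the limit $$\rho_t(A)=\lim_{L\to\infty}(\otimes_{\Lambda_L}\rho)\bigl(\tau_t^{(L)}(A)\bigr)$$ exists, and for all $t\in\mathbb{R}$: (i) $\mathrm{d}(\rho):=\rho(n_{0,\uparrow}+n_{0,\downarrow})=\rho_{t=0}(n_{0,\uparrow}+n_{0,\downarrow})=\rho_t(n_{0,\uparrow}+n_{0,\downarrow})\in[0,2]$; (ii) $\mathrm{m}(\rho):=\rho(n_{0,\uparrow}-n_{0,\downarrow})=\rho_{t=0}(n_{0,\uparrow}-n_{0,\downarrow})=\rho_t(n_{0,\uparrow}-n_{0,\downarrow})\in[-1,1]$; (iii) $\mathrm{w}(\rho):=\rho(n_{0,\uparrow}n_{0,\downarrow})=\rho_{t=0}(n_{0,\uparrow}n_{0,\downarrow})=\rho_t(n_{0,\uparrow}n_{0,\downarrow})\in[0,1]$;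 (iv) there are $\kappa(\rho)\in[0,1]$ and $\theta(\rho)\in[-\pi,\pi)$ with $\rho(a_{0,\downarrow}a_{0,\uparrow})=\sqrt{\kappa(\rho)}\,e^{i\theta(\rho)}$, and for every such choice $$\rho_t(a_{0,\downarrow}a_{0,\uparrow})=\sqrt{\kappa(\rho)}\,e^{i(t\nu(\rho)+\theta(\rho))},\qquad \nu(\rho):=2(\mu-\lambda)+\gamma(1-\mathrm{d}(\rho)).$$ -/

import Mathlib

namespace BCSHubbard

open Matrix

/-! Fermions with two spin states on the sites of the lattice `ℤ^d`. -/

/-- The two spin states. -/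
inductive Spin : Type
  | up : Spin
  | down : Spin

/-- Linear operators on the one-site Fock space `⋀ ℂ^{↑,↓} ≡ ℂ⁴`, in the orthonormal basis
`0 = vacuum`, `1 = a↑* vacuum`, `2 = a↓* vacuum`, `3 = a↑* a↓* vacuum`. -/
abbrev SiteOp : Type := Matrix (Fin 4) (Fin 4) ℂ

/-- One-site annihilation operators `a↑`, `a↓`. -/
def siteAnn : Spin → SiteOp
  | Spin.up => !![0, 1, 0, 0; 0, 0, 0, 0; 0, 0, 0, 1; 0, 0, 0, 0]
  | Spin.down => !![0, 0, 1, 0; 0, 0, 0, -1; 0, 0, 0, 0; 0, 0, 0, 0]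

/-- One-site particle number operators `n_s = a_s* a_s`. -/
def siteNum (s : Spin) : SiteOp := (siteAnn s)ᴴ * siteAnn s

/-- The one-site parity `(-1)^(n↑ + n↓)`. -/
def siteParity : SiteOp := Matrix.diagonal ![1, -1, -1, 1]

/-- The letter `(s, false)` stands for `a_s`, the letter `(s, true)` for `a_s*`. -/
def siteLetter (l : Spin × Bool) : SiteOp :=
  if l.2 then (siteAnn l.1)ᴴ else siteAnn l.1

/-- Monomials in `a↑, a↓, a↑*, a↓*`. -/
def siteWord (w : List (Spin × Bool)) : SiteOp := (w.map siteLetter).prod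

open scoped ComplexOrder in
/-- States of one site: positive normalized linear functionals. -/
def IsSiteState (ρ : SiteOp →ₗ[ℂ] ℂ) : Prop :=
  (∀ A : SiteOp, 0 ≤ ρ (Aᴴ * A)) ∧ ρ 1 = 1

/-- Even functionals: they vanish on all odd monomials in `a↑, a↓, a↑*, a↓*`. -/
def IsEvenFunctional (ρ : SiteOp →ₗ[ℂ] ℂ) : Prop :=
  ∀ w : List (Spin × Bool), Odd w.length → ρ (siteWord w) = 0

/-- The cubic box `Λ_L = {-L, …, L}^d`. -/
noncomputable def box (d L : ℕ) : Finset (Fin d → ℤ) :=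
  Fintype.piFinset fun _ => Finset.Icc (-(L : ℤ)) (L : ℤ)

/-- Linear operators on the Fock space `⋀ ℂ^(Λ_L × {↑,↓}) ≡ ⨂_{x ∈ Λ_L} ℂ⁴` of the box,
as matrices with respect to the occupation-number basis. -/
abbrev BoxOp (d L : ℕ) : Type := Matrix (box d L → Fin 4) (box d L → Fin 4) ℂ

/-- The tensor product over the sites of the box of one-site matrices. -/
noncomputable def siteTensor {d L : ℕ} (B : box d L → SiteOp) : BoxOp d L :=
  Matrix.of fun σ τ => ∏ x, B x (σ x) (τ x)

/-- The key by which lattice sites are totally ordered: first the sup norm, then the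
lexicographic order. In this order the sites of a smaller box precede the other sites of a
larger one. -/
noncomputable def siteKey {d : ℕ} (x : Fin d → ℤ) : ℕ ×ₗ Lex (Fin d → ℤ) :=
  toLex (Finset.univ.sup fun i => (x i).natAbs, toLex x)

open scoped Classical in
/-- The annihilation operator `a_{x,s}` on the Fock space of the box (Jordan-Wigner form: the
sites that precede `x` contribute their parity). -/
noncomputable def ann {d L : ℕ} (x : box d L) (s : Spin) : BoxOp d L :=
  siteTensor fun y =>
    if siteKey y.1 < siteKey x.1 then siteParity else if y = x then siteAnn s else 1

/-- The creation operator `a_{x,s}*`. -/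
noncomputable def cre {d L : ℕ} (x : box d L) (s : Spin) : BoxOp d L := (ann x s)ᴴ

/-- The particle number operator `n_{x,s} = a_{x,s}* a_{x,s}`. -/
noncomputable def num {d L : ℕ} (x : box d L) (s : Spin) : BoxOp d L := cre x s * ann x s

/-- The origin of the lattice, as a site of the box. -/
noncomputable def origin (d L : ℕ) : box d L :=
  ⟨0, by simp [box, Fintype.mem_piFinset]⟩

/-- The on-site term
`h_x = 2 lam n_{x,↑} n_{x,↓} - mu (n_{x,↑} + n_{x,↓}) - h (n_{x,↑} - n_{x,↓})`. -/
noncomputable def onSite {d L : ℕ} (mu h lam : ℝ) (x : box d L) : BoxOp d L :=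
  ((2 * lam : ℝ) : ℂ) • (num x Spin.up * num x Spin.down)
    - (mu : ℂ) • (num x Spin.up + num x Spin.down)
    - (h : ℂ) • (num x Spin.up - num x Spin.down)

/-- The strong-coupling BCS-Hubbard Hamiltonian
`H_L = ∑_x h_x - (gam / |Λ_L|) ∑_{x,y} a_{x,↑}* a_{x,↓}* a_{y,↓} a_{y,↑}`. -/
noncomputable def hamiltonian (d L : ℕ) (mu h lam gam : ℝ) : BoxOp d L :=
  (∑ x : box d L, onSite mu h lam x)
    - ((gam / ((box d L).card : ℝ) : ℝ) : ℂ) •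
      ∑ x : box d L, ∑ y : box d L,
        cre x Spin.up * cre x Spin.down * (ann y Spin.down * ann y Spin.up)

/-- The Heisenberg dynamics `τ_t(A) = exp(i t H_L) A exp(-i t H_L)`. -/
noncomputable def evolve {d L : ℕ} (mu h lam gam t : ℝ) (A : BoxOp d L) : BoxOp d L :=
  NormedSpace.exp ((Complex.I * (t : ℂ)) • hamiltonian d L mu h lam gam) * A *
    NormedSpace.exp (-((Complex.I * (t : ℂ)) • hamiltonian d L mu h lam gam))

/-- The product functional `⨂_{Λ_L} ρ`, by its values
`∏_x ρ(|σ_x⟩⟨τ_x|)` on the matrix units `⨂_x |σ_x⟩⟨τ_x|`. -/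
noncomputable def productState {d : ℕ} (ρ : SiteOp →ₗ[ℂ] ℂ) (L : ℕ) (A : BoxOp d L) : ℂ :=
  ∑ σ : box d L → Fin 4, ∑ τ : box d L → Fin 4,
    A σ τ * ∏ x, ρ (Matrix.single (σ x) (τ x) 1)

theorem box_mono {d L₀ L : ℕ} (h : L₀ ≤ L) : box d L₀ ⊆ box d L := by
  intro x hx
  simp only [box, Fintype.mem_piFinset, Finset.mem_Icc] at hx ⊢
  intro i
  have := hx i
  omega

open scoped Classical in
/-- For `L₀ ≤ L`, the inclusion of the operators on the Fock space of `Λ_{L₀}` into those on the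
Fock space of `Λ_L`, which maps `a_{x,s}` to `a_{x,s}`. As the sites of `Λ_{L₀}` precede the
others, it is `A ↦ A ⊗ 1`. (For `L < L₀` the value is irrelevant.) -/
noncomputable def incl {d : ℕ} (L₀ L : ℕ) (A : BoxOp d L₀) : BoxOp d L :=
  if h : L₀ ≤ L then
    Matrix.of fun σ τ =>
      if ∀ x : box d L, x.1 ∉ box d L₀ → σ x = τ x then
        A (fun x => σ ⟨x.1, box_mono h x.2⟩) (fun x => τ ⟨x.1, box_mono h x.2⟩)
      else 0
  else 0

/-! The definitions have the expected algebraic properties. -/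

theorem siteTensor_mul {d L : ℕ} (B C : box d L → SiteOp) :
    siteTensor B * siteTensor C = siteTensor fun x => B x * C x := by
  ext σ τ
  simp only [siteTensor, Matrix.mul_apply, Matrix.of_apply, ← Finset.prod_mul_distrib]
  rw [Finset.prod_univ_sum]
  simp [Fintype.piFinset_univ]

theorem siteTensor_conjTranspose {d L : ℕ} (B : box d L → SiteOp) :
    (siteTensor B)ᴴ = siteTensor fun x => (B x)ᴴ := by
  ext σ τ
  simp [siteTensor, Matrix.conjTranspose_apply]

theorem siteTensor_one {d L : ℕ} : siteTensor (fun _ : box d L => (1 : SiteOp)) = 1 := by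
  classical
  ext σ τ
  simp only [siteTensor, Matrix.of_apply, Matrix.one_apply]
  by_cases h : σ = τ
  · simp [h]
  · rw [if_neg h]
    obtain ⟨x, hx⟩ := Function.ne_iff.mp h
    exact Finset.prod_eq_zero (Finset.mem_univ x) (if_neg hx)

/-- On tensor products the product functional is the product of the values of `ρ`. -/
theorem productState_siteTensor {d L : ℕ} (ρ : SiteOp →ₗ[ℂ] ℂ) (B : box d L → SiteOp) :
    productState ρ L (siteTensor B) = ∏ x, ρ (B x) := by
  have h : ∀ x, ρ (B x) = ∑ p : Fin 4 × Fin 4, B x p.1 p.2 * ρ (Matrix.single p.1 p.2 1) := by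
    intro x
    conv_lhs => rw [Matrix.matrix_eq_sum_single (B x)]
    rw [map_sum, Fintype.sum_prod_type]
    refine Finset.sum_congr rfl fun i _ => ?_
    rw [map_sum]
    refine Finset.sum_congr rfl fun j _ => ?_
    rw [← smul_eq_mul, ← map_smul]
    simp
  simp_rw [h]
  rw [Finset.prod_univ_sum, Fintype.piFinset_univ]
  unfold productState
  rw [← Fintype.sum_prod_type']
  refine Fintype.sum_equiv (Equiv.arrowProdEquivProdArrow _ _ _).symm _ _ fun p => ?_
  simp [siteTensor, Finset.prod_mul_distrib, Equiv.arrowProdEquivProdArrow]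

theorem productState_one {d L : ℕ} (ρ : SiteOp →ₗ[ℂ] ℂ) (hρ : ρ 1 = 1) :
    productState ρ L (1 : BoxOp d L) = 1 := by
  rw [← siteTensor_one, productState_siteTensor]
  simp [hρ]

open scoped Classical in
/-- The one-site operator `u` at `x`, with the parities of the preceding sites. -/
noncomputable def stringTensor {d L : ℕ} (x : box d L) (u : SiteOp) : BoxOp d L :=
  siteTensor fun y =>
    if siteKey y.1 < siteKey x.1 then siteParity else if y = x then u else 1

theorem siteParity_mul_self : siteParity * siteParity = 1 := by
  ext i j
  fin_cases i <;> fin_cases j <;> simp [siteParity]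

theorem siteParity_conjTranspose : siteParityᴴ = siteParity := by
  ext i j
  fin_cases i <;> fin_cases j <;> simp [siteParity, Matrix.diagonal, Matrix.conjTranspose_apply]

theorem siteAnn_anticomm_parity (s : Spin) :
    siteAnn s * siteParity + siteParity * siteAnn s = 0 := by
  cases s <;> ext i j <;> simp only [Matrix.add_apply, Matrix.mul_apply, Fin.sum_univ_four] <;>
    fin_cases i <;> fin_cases j <;> simp [siteParity, siteAnn]

theorem siteCre_anticomm_parity (s : Spin) :
    (siteAnn s)ᴴ * siteParity + siteParity * (siteAnn s)ᴴ = 0 := by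
  have h := congrArg Matrix.conjTranspose (siteAnn_anticomm_parity s)
  rw [Matrix.conjTranspose_add, Matrix.conjTranspose_mul, Matrix.conjTranspose_mul,
    siteParity_conjTranspose, Matrix.conjTranspose_zero] at h
  rw [add_comm, h]

theorem siteLetter_anticomm_parity (l : Spin × Bool) :
    siteLetter l * siteParity + siteParity * siteLetter l = 0 := by
  unfold siteLetter
  split_ifs
  · exact siteCre_anticomm_parity l.1
  · exact siteAnn_anticomm_parity l.1

/-- The one-site canonical anticommutation relations. -/
theorem siteAnn_siteAnn (s t : Spin) : siteAnn s * siteAnn t + siteAnn t * siteAnn s = 0 := by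
  cases s <;> cases t <;> ext i j <;> fin_cases i <;> fin_cases j <;> simp [siteAnn]

theorem siteAnn_siteCre (s : Spin) :
    siteAnn s * (siteAnn s)ᴴ + (siteAnn s)ᴴ * siteAnn s = 1 := by
  cases s <;> ext i j <;> simp only [Matrix.add_apply, Matrix.mul_apply, Fin.sum_univ_four] <;>
    fin_cases i <;> fin_cases j <;> simp [siteAnn]

theorem siteAnn_siteCre_of_ne (s t : Spin) (h : s ≠ t) :
    siteAnn s * (siteAnn t)ᴴ + (siteAnn t)ᴴ * siteAnn s = 0 := by
  cases s <;> cases t <;> first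
    | exact absurd rfl h
    | (ext i j
       simp only [Matrix.add_apply, Matrix.mul_apply, Fin.sum_univ_four]
       fin_cases i <;> fin_cases j <;> simp [siteAnn])

theorem siteKey_injective {d : ℕ} : Function.Injective (siteKey (d := d)) := by
  intro x y h
  have h2 := congrArg (fun k => ofLex (ofLex k).2) h
  exact h2

theorem ann_eq {d L : ℕ} (x : box d L) (s : Spin) : ann x s = stringTensor x (siteAnn s) := rfl

theorem cre_eq {d L : ℕ} (x : box d L) (s : Spin) :
    cre x s = stringTensor x (siteAnn s)ᴴ := by
  rw [cre, ann_eq, stringTensor, siteTensor_conjTranspose, stringTensor]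
  congr 1
  funext y
  split_ifs
  · exact siteParity_conjTranspose
  · rfl
  · exact Matrix.conjTranspose_one

theorem siteTensor_add {d L : ℕ} {B C D : box d L → SiteOp} (z : box d L)
    (hz : B z + C z = D z) (hB : ∀ y, y ≠ z → B y = D y) (hC : ∀ y, y ≠ z → C y = D y) :
    siteTensor B + siteTensor C = siteTensor D := by
  classical
  ext σ τ
  simp only [siteTensor, Matrix.add_apply, Matrix.of_apply]
  rw [Fintype.prod_eq_mul_prod_compl z, Fintype.prod_eq_mul_prod_compl z,
    Fintype.prod_eq_mul_prod_compl z (f := fun x => D x (σ x) (τ x)), ← hz, Matrix.add_apply,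
    add_mul]
  congr 2 <;> refine Finset.prod_congr rfl fun y hy => ?_
  · rw [hB y (by simpa using hy)]
  · rw [hC y (by simpa using hy)]

theorem siteTensor_zero {d L : ℕ} {B : box d L → SiteOp} (z : box d L) (hz : B z = 0) :
    siteTensor B = 0 := by
  ext σ τ
  simp only [siteTensor, Matrix.of_apply]
  exact Finset.prod_eq_zero (Finset.mem_univ z) (by rw [hz]; rfl)

theorem stringTensor_anticomm_of_lt {d L : ℕ} {x y : box d L}
    (h : siteKey x.1 < siteKey y.1) {u : SiteOp} (hu : u * siteParity + siteParity * u = 0)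
    (v : SiteOp) :
    stringTensor x u * stringTensor y v + stringTensor y v * stringTensor x u = 0 := by
  classical
  rw [stringTensor, stringTensor, siteTensor_mul, siteTensor_mul]
  have hxy : x ≠ y := fun e => by simp [e] at h
  rw [siteTensor_add (D := fun w => if w = x then 0 else
      (if siteKey w.1 < siteKey x.1 then siteParity else if w = x then u else 1) *
      (if siteKey w.1 < siteKey y.1 then siteParity else if w = y then v else 1)) x]
  · exact siteTensor_zero x (by simp)
  · simpa [h] using hu
  · intro w hw
    simp [hw]
  · intro w hw
    by_cases h1 : siteKey w.1 < siteKey x.1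
    · simp [hw, h1, h1.trans h]
    · simp [hw, h1]

theorem stringTensor_anticomm {d L : ℕ} {x y : box d L} (h : x ≠ y) {u v : SiteOp}
    (hu : u * siteParity + siteParity * u = 0) (hv : v * siteParity + siteParity * v = 0) :
    stringTensor x u * stringTensor y v + stringTensor y v * stringTensor x u = 0 := by
  rcases lt_trichotomy (siteKey x.1) (siteKey y.1) with h1 | h1 | h1
  · exact stringTensor_anticomm_of_lt h1 hu v
  · exact absurd (Subtype.ext (siteKey_injective h1)) h
  · rw [add_comm]
    exact stringTensor_anticomm_of_lt h1 hv u

open scoped Classical in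
theorem stringTensor_mul_self {d L : ℕ} (x : box d L) (u v : SiteOp) :
    stringTensor x u * stringTensor x v = siteTensor fun y => if y = x then u * v else 1 := by
  rw [stringTensor, stringTensor, siteTensor_mul]
  congr 1
  funext y
  by_cases hy : y = x
  · subst hy
    simp
  · by_cases h1 : siteKey y.1 < siteKey x.1
    · simp [hy, h1, siteParity_mul_self]
    · simp [hy, h1]

theorem stringTensor_anticomm_self {d L : ℕ} (x : box d L) {u v : SiteOp} (c : ℂ)
    (h : u * v + v * u = c • (1 : SiteOp)) :
    stringTensor x u * stringTensor x v + stringTensor x v * stringTensor x u =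
      c • (1 : BoxOp d L) := by
  classical
  rw [stringTensor_mul_self, stringTensor_mul_self, siteTensor_add
    (D := fun y => if y = x then c • (1 : SiteOp) else 1) x (by simpa using h)
    (fun y hy => by simp [hy]) (fun y hy => by simp [hy]), ← siteTensor_one]
  ext σ τ
  simp only [siteTensor, Matrix.of_apply, Matrix.smul_apply]
  rw [Fintype.prod_eq_mul_prod_compl x,
    Fintype.prod_eq_mul_prod_compl x (f := fun y => (1 : SiteOp) (σ y) (τ y)), smul_eq_mul,
    ← mul_assoc]
  congr 1
  · simp
  · refine Finset.prod_congr rfl fun y hy => ?_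
    rw [if_neg (by simpa using hy)]

/-- Canonical anticommutation relations. -/
theorem ann_ann {d L : ℕ} (x y : box d L) (s t : Spin) :
    ann x s * ann y t + ann y t * ann x s = 0 := by
  rw [ann_eq, ann_eq]
  by_cases h : x = y
  · subst h
    rw [stringTensor_anticomm_self x 0 (by rw [siteAnn_siteAnn, zero_smul]), zero_smul]
  · exact stringTensor_anticomm h (siteAnn_anticomm_parity s) (siteAnn_anticomm_parity t)

open scoped Classical in
/-- Canonical anticommutation relations. -/
theorem ann_cre {d L : ℕ} (x y : box d L) (s t : Spin) :
    ann x s * cre y t + cre y t * ann x s = if x = y ∧ s = t then 1 else 0 := by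
  rw [ann_eq, cre_eq]
  by_cases h : x = y
  · subst h
    by_cases hs : s = t
    · subst hs
      rw [stringTensor_anticomm_self x 1 (by rw [siteAnn_siteCre, one_smul]), one_smul]
      simp
    · rw [stringTensor_anticomm_self x 0 (by rw [siteAnn_siteCre_of_ne s t hs, zero_smul]),
        zero_smul]
      simp [hs]
  · rw [stringTensor_anticomm h (siteAnn_anticomm_parity s) (siteCre_anticomm_parity t)]
    simp [h]

theorem siteKey_lt_of_notMem {d L₀ : ℕ} {x y : Fin d → ℤ} (hx : x ∈ box d L₀)
    (hy : y ∉ box d L₀) : siteKey x < siteKey y := by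
  refine Prod.Lex.toLex_lt_toLex.mpr (Or.inl ?_)
  have h1 : (Finset.univ.sup fun i => (x i).natAbs) ≤ L₀ := by
    refine Finset.sup_le fun i _ => ?_
    have := (Finset.mem_Icc.mp (Fintype.mem_piFinset.mp hx i))
    omega
  refine lt_of_le_of_lt h1 ?_
  by_contra hc
  refine hy (Fintype.mem_piFinset.mpr fun i => Finset.mem_Icc.mpr ?_)
  have h2 : (y i).natAbs ≤ L₀ :=
    (Finset.le_sup (f := fun i => (y i).natAbs) (Finset.mem_univ i)).trans (not_lt.mp hc)
  omega

/-- The inclusions of the algebras of the boxes map annihilation operators to annihilation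
operators. -/
theorem incl_ann {d L₀ L : ℕ} (h : L₀ ≤ L) (x : box d L₀) (s : Spin) :
    incl L₀ L (ann x s) = ann (⟨x.1, box_mono h x.2⟩ : box d L) s := by
  classical
  ext σ τ
  simp only [incl, dif_pos h, Matrix.of_apply, ann, siteTensor]
  set f : box d L → ℂ := fun y =>
    (if siteKey y.1 < siteKey x.1 then siteParity
      else if y = ⟨x.1, box_mono h x.2⟩ then siteAnn s else 1) (σ y) (τ y) with hf
  have hout : ∀ y : box d L, y.1 ∉ box d L₀ → f y = (1 : SiteOp) (σ y) (τ y) := by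
    intro y hy
    have h1 := siteKey_lt_of_notMem x.2 hy
    have h2 : y ≠ ⟨x.1, box_mono h x.2⟩ := fun e => hy (by rw [e]; exact x.2)
    simp only [hf, if_neg h1.not_gt, if_neg h2]
  by_cases hσ : ∀ y : box d L, y.1 ∉ box d L₀ → σ y = τ y
  · rw [if_pos hσ]
    let e : box d L₀ → box d L := fun y => ⟨y.1, box_mono h y.2⟩
    have he : Function.Injective e := fun a b hab => Subtype.ext (congrArg (fun z => z.1) hab)
    rw [← Finset.prod_subset (Finset.subset_univ (Finset.univ.image e)),
      Finset.prod_image (fun a _ b _ hab => he hab)]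
    · refine Finset.prod_congr rfl fun y _ => ?_
      have : (e y = ⟨x.1, box_mono h x.2⟩) ↔ y = x := by
        rw [show (⟨x.1, box_mono h x.2⟩ : box d L) = e x from rfl, he.eq_iff]
      simp only [this]
      rfl
    · intro y _ hy
      have hy' : y.1 ∉ box d L₀ := fun hm =>
        hy (Finset.mem_image.mpr ⟨⟨y.1, hm⟩, Finset.mem_univ _, rfl⟩)
      change f y = 1
      rw [hout y hy', hσ y hy', Matrix.one_apply_eq]
  · rw [if_neg hσ]
    push Not at hσ
    obtain ⟨y, hy, hne⟩ := hσ
    refine (Finset.prod_eq_zero (Finset.mem_univ y) ?_).symm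
    change f y = 0
    rw [hout y hy, Matrix.one_apply_ne hne]

/-- Monomials in the creation and annihilation operators of the site `x`. -/
noncomputable def boxWord {d L : ℕ} (x : box d L) (w : List (Spin × Bool)) : BoxOp d L :=
  (w.map fun l => if l.2 then cre x l.1 else ann x l.1).prod

open scoped Classical in
theorem boxWord_eq {d L : ℕ} (x : box d L) (w : List (Spin × Bool)) :
    boxWord x w = siteTensor fun y =>
      if siteKey y.1 < siteKey x.1 then siteParity ^ w.length
      else if y = x then siteWord w else 1 := by
  induction w with
  | nil => simp [boxWord, siteWord, siteTensor_one]
  | cons l w ih =>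
    have h1 : (if l.2 then cre x l.1 else ann x l.1) = stringTensor x (siteLetter l) := by
      unfold siteLetter
      split_ifs
      · exact cre_eq x l.1
      · rfl
    have h2 : boxWord x (l :: w) = stringTensor x (siteLetter l) * boxWord x w := by
      rw [← h1]
      simp [boxWord]
    rw [h2, ih, stringTensor, siteTensor_mul]
    congr 1
    funext y
    split_ifs
    · rw [List.length_cons, pow_succ']
    · simp [siteWord]
    · simp

open scoped Classical in
theorem boxWords_eq {d L : ℕ} (l : List (box d L × List (Spin × Bool))) :
    (l.map fun p => boxWord p.1 p.2).prod = siteTensor fun y =>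
      (l.map fun p => if siteKey y.1 < siteKey p.1.1 then siteParity ^ p.2.length
        else if y = p.1 then siteWord p.2 else 1).prod := by
  induction l with
  | nil => simp [siteTensor_one]
  | cons p l ih => rw [List.map_cons, List.prod_cons, ih, boxWord_eq, siteTensor_mul]; rfl

theorem siteParity_pow_even {n : ℕ} (h : Even n) : siteParity ^ n = 1 := by
  obtain ⟨k, rfl⟩ := h
  rw [← two_mul, pow_mul, pow_two, siteParity_mul_self, one_pow]

theorem list_prod_single {α : Type*} (l : List (α × List (Spin × Bool)))
    (g : α × List (Spin × Bool) → SiteOp) (hn : (l.map Prod.fst).Nodup)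
    (p : α × List (Spin × Bool)) (hp : p ∈ l) (hg : ∀ q ∈ l, q.1 ≠ p.1 → g q = 1) :
    (l.map g).prod = g p := by
  induction l with
  | nil => simp at hp
  | cons q l ih =>
    rw [List.map_cons, List.nodup_cons] at hn
    rw [List.map_cons, List.prod_cons]
    rcases List.mem_cons.mp hp with rfl | hp'
    · have : (l.map g).prod = 1 := by
        refine List.prod_eq_one fun a ha => ?_
        obtain ⟨r, hr, rfl⟩ := List.mem_map.mp ha
        refine hg r (List.mem_cons_of_mem _ hr) fun e => hn.1 ?_
        rw [← e]
        exact List.mem_map_of_mem hr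
      rw [this, mul_one]
    · rw [ih hn.2 hp' fun r hr => hg r (List.mem_cons_of_mem _ hr),
        hg q List.mem_cons_self fun e => hn.1 (by rw [e]; exact List.mem_map_of_mem hp'), one_mul]

/-- The product functional of an even normalized `ρ` satisfies
`ω(α_{x₁}(A₁) ⋯ α_{xₙ}(Aₙ)) = ρ(A₁) ⋯ ρ(Aₙ)` for distinct sites `x₁, …, xₙ` and monomials
`A₁, …, Aₙ` in the one-site creation and annihilation operators. -/
theorem productState_boxWords {d L : ℕ} (ρ : SiteOp →ₗ[ℂ] ℂ) (hρ : ρ 1 = 1)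
    (he : IsEvenFunctional ρ) (l : List (box d L × List (Spin × Bool)))
    (hn : (l.map Prod.fst).Nodup) :
    productState ρ L (l.map fun p => boxWord p.1 p.2).prod =
      (l.map fun p => ρ (siteWord p.2)).prod := by
  classical
  rw [boxWords_eq, productState_siteTensor]
  by_cases hodd : ∃ p ∈ l, Odd p.2.length
  · obtain ⟨p₀, hp₀, ho₀⟩ := hodd
    obtain ⟨p, hp, hmax⟩ := Finset.exists_max_image
      (l.toFinset.filter fun p => Odd p.2.length) (fun p => siteKey p.1.1)
      ⟨p₀, by simpa using ⟨hp₀, ho₀⟩⟩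
    simp only [Finset.mem_filter, List.mem_toFinset] at hp hmax
    rw [Finset.prod_eq_zero (Finset.mem_univ p.1), eq_comm]
    · exact List.prod_eq_zero (List.mem_map.mpr ⟨p, hp.1, he _ hp.2⟩)
    · rw [list_prod_single l _ hn p hp.1]
      · simpa using he _ hp.2
      · intro q hq hqp
        split_ifs with h1 h2
        · refine siteParity_pow_even ?_
          by_contra hc
          exact absurd (hmax q ⟨hq, Nat.not_even_iff_odd.mp hc⟩) (not_le.mpr h1)
        · exact absurd h2.symm hqp
        · rfl
  · push Not at hodd
    have hev : ∀ p ∈ l, Even p.2.length := fun p hp => Nat.not_odd_iff_even.mp (hodd p hp)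
    have hfac : ∀ y : box d L, (l.map fun p =>
        if siteKey y.1 < siteKey p.1.1 then siteParity ^ p.2.length
        else if y = p.1 then siteWord p.2 else 1) =
        l.map fun p => if y = p.1 then siteWord p.2 else 1 := by
      intro y
      refine List.map_congr_left fun p hp => ?_
      split_ifs with h1 h2
      · simp [h2] at h1
      · exact siteParity_pow_even (hev p hp)
      · rfl
      · rfl
    simp_rw [hfac]
    have hl : l.Nodup := List.Nodup.of_map _ hn
    rw [← List.prod_toFinset _ hl]
    have hinj : Set.InjOn Prod.fst (l.toFinset : Set (box d L × List (Spin × Bool))) := by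
      intro a ha b hb hab
      exact List.inj_on_of_nodup_map hn (by simpa using ha) (by simpa using hb) hab
    rw [← Finset.prod_subset (Finset.subset_univ (l.toFinset.image Prod.fst)),
      Finset.prod_image hinj]
    · refine Finset.prod_congr rfl fun p hp => ?_
      rw [list_prod_single l _ hn p (by simpa using hp) fun q _ hqp => if_neg (Ne.symm hqp),
        if_pos rfl]
    · intro y _ hy
      rw [List.prod_eq_one, hρ]
      intro a ha
      obtain ⟨q, hq, rfl⟩ := List.mem_map.mp ha
      refine if_neg fun e => hy ?_
      rw [e]
      exact Finset.mem_image_of_mem _ (by simpa using hq)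

end BCSHubbard

/-! The model is a mean-field model, and one of its means can be evolved exactly. The number
operators and the pair `a↓ a↑` have even degree at one site, so the Jordan-Wigner parities cancel
and `H = ∑ₓ hₓ - γ (∑ₓ pₓ*) P`, where `p` is the one-site pair and `P` is the mean of its copies
(`hamiltonian_eq`). Copies at distinct sites commute, so commutators of sums are computed on one
site.

Means of diagonal one-site operators commute with `H` (`commute_mean_hamiltonian`). With `Ω = 2(μ-λ)
- γ · mean(n - 1)`, which commutes with `H`, one has `[H, P] = Ω P`, so `τ_t(P) = exp(itΩ) P`
exactly in every finite box (`heisenberg_mean_pair`). In the product state `P` and `Ω` have variance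
`O(1/|Λ|)`. Hence at time `t` the operator `P` is close in mean square to the number `z_t = exp(itν)
ρ(p)`, uniformly for bounded `t` (`exists_fluctuation_le`). Permutation invariance equates the
expectation at one site with that of the mean (`evolvedState_siteEmb`), which yields the conserved
densities and the rotating Cooper field.

For a general local observable `A`, the commutator `[H, A]` consists of local terms and of local
terms times `P` or `P*`. Replacing `P` by `z_t` leaves a linear ODE for functionals on the fixed
small box, the same for every `L`; Cauchy-Schwarz bounds the error by a constant times
`|Λ_L|^(-1/2)` (`norm_map_lie_sub_effGen_le`). The initial values agree for all `L`, so Grönwall's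
inequality makes the expectations a Cauchy sequence (`exists_tendsto_evolvedState`). -/

namespace BCSHubbard

open Matrix
open scoped ComplexOrder

/-! ### States on matrix algebras: Cauchy-Schwarz and density matrices. -/

/-- States on a matrix algebra: positive normalized linear functionals. -/
structure IsState {ι : Type*} [Fintype ι] [DecidableEq ι] (φ : Matrix ι ι ℂ →ₗ[ℂ] ℂ) : Prop where
  nonneg : ∀ A, 0 ≤ φ (Aᴴ * A)
  map_one : φ 1 = 1

namespace IsState

variable {ι : Type*} [Fintype ι] [DecidableEq ι] {φ : Matrix ι ι ℂ →ₗ[ℂ] ℂ}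

/-- Polarization: the values of `φ` on the squares of `A`, `A + 1` and `A + i` are real, which fixes
the imaginary and the real part of `φ Aᴴ`. -/
theorem map_conjTranspose (hφ : IsState φ) (A : Matrix ι ι ℂ) : φ Aᴴ = star (φ A) := by
  have h0 := (Complex.nonneg_iff.mp (hφ.nonneg A)).2
  have h1 := (Complex.nonneg_iff.mp (hφ.nonneg (A + 1))).2
  have h2 := (Complex.nonneg_iff.mp (hφ.nonneg (A + Complex.I • 1))).2
  simp only [conjTranspose_add, conjTranspose_one, conjTranspose_smul, add_mul, mul_add, one_mul,
    mul_one, map_add, smul_mul_assoc, mul_smul_comm, map_smul, hφ.map_one, smul_eq_mul,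
    Complex.add_im, Complex.mul_im, Complex.star_def, Complex.conj_I,
    Complex.I_re, Complex.I_im, Complex.neg_re, Complex.neg_im,
    Complex.one_im] at h0 h1 h2
  apply Complex.ext
  · simp only [Complex.star_def, Complex.conj_re]
    linarith
  · simp only [Complex.star_def, Complex.conj_im]
    linarith

/-- The semi-inner product `⟨A, B⟩ = φ (Aᴴ B)` of a state. -/
@[reducible] noncomputable def core (hφ : IsState φ) :
    PreInnerProductSpace.Core ℂ (Matrix ι ι ℂ) where
  inner A B := φ (Aᴴ * B)
  conj_inner_symm A B := by
    rw [← Complex.star_def, ← hφ.map_conjTranspose, conjTranspose_mul, conjTranspose_conjTranspose]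
  re_inner_nonneg A := (Complex.nonneg_iff.mp (hφ.nonneg A)).1
  add_left A B C := by rw [conjTranspose_add, add_mul, map_add]
  smul_left A B r := by
    rw [conjTranspose_smul, smul_mul_assoc, map_smul, smul_eq_mul, Complex.star_def]

theorem norm_sq_le (hφ : IsState φ) (A B : Matrix ι ι ℂ) :
    ‖φ (Aᴴ * B)‖ ^ 2 ≤ (φ (Aᴴ * A)).re * (φ (Bᴴ * B)).re := by
  let := hφ.core
  have h := InnerProductSpace.Core.inner_mul_inner_self_le (𝕜 := ℂ) A B
  have e : ‖φ (Bᴴ * A)‖ = ‖φ (Aᴴ * B)‖ := by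
    rw [← norm_star, ← hφ.map_conjTranspose, conjTranspose_mul, conjTranspose_conjTranspose]
  calc ‖φ (Aᴴ * B)‖ ^ 2 = ‖φ (Aᴴ * B)‖ * ‖φ (Bᴴ * A)‖ := by rw [e, sq]
    _ ≤ _ := h

theorem norm_le_sqrt (hφ : IsState φ) {A B : Matrix ι ι ℂ} (hA : (φ (Aᴴ * A)).re ≤ 1) :
    ‖φ (Aᴴ * B)‖ ≤ √(φ (Bᴴ * B)).re := by
  refine Real.le_sqrt_of_sq_le ((hφ.norm_sq_le A B).trans ?_)
  have := (Complex.nonneg_iff.mp (hφ.nonneg B)).1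
  nlinarith

theorem norm_map_le_sqrt (hφ : IsState φ) (B : Matrix ι ι ℂ) : ‖φ B‖ ≤ √(φ (Bᴴ * B)).re := by
  simpa using hφ.norm_le_sqrt (A := 1) (B := B) (by simp [hφ.map_one])

theorem map_projection_nonneg (hφ : IsState φ) {P : Matrix ι ι ℂ} (h : Pᴴ = P) (h2 : P * P = P) :
    0 ≤ φ P := by
  have := hφ.nonneg P
  rwa [h, h2] at this

theorem map_projection_le_one (hφ : IsState φ) {P : Matrix ι ι ℂ} (h : Pᴴ = P) (h2 : P * P = P) :
    φ P ≤ 1 := by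
  have := hφ.map_projection_nonneg (P := 1 - P) (by simp [h]) (by simp [mul_sub, sub_mul, h2])
  rwa [map_sub, hφ.map_one, sub_nonneg] at this

/-- Parallelogram law, with the nonnegative square of `A - B` dropped. -/
theorem re_add_le (hφ : IsState φ) (A B : Matrix ι ι ℂ) :
    (φ ((A + B)ᴴ * (A + B))).re ≤ 2 * (φ (Aᴴ * A)).re + 2 * (φ (Bᴴ * B)).re := by
  have := (Complex.nonneg_iff.mp (hφ.nonneg (A - B))).1
  simp only [conjTranspose_add, conjTranspose_sub, add_mul, mul_add, sub_mul, mul_sub, map_add,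
    map_sub, Complex.add_re, Complex.sub_re] at this ⊢
  linarith

/-- A state is `A ↦ tr (A Sᴴ S)` for some matrix `S`. -/
theorem exists_density (hφ : IsState φ) :
    ∃ S : Matrix ι ι ℂ, ∀ i j, φ (single i j 1) = (Sᴴ * S) j i := by
  rcases isEmpty_or_nonempty ι with _ | ⟨⟨i₀⟩⟩
  · exact ⟨0, fun i => isEmptyElim i⟩
  have hR : (Matrix.of fun j i => φ (single i j 1)).PosSemidef := by
    rw [posSemidef_iff_dotProduct_mulVec]
    refine ⟨?_, fun v => ?_⟩
    · ext i j
      rw [conjTranspose_apply, of_apply, of_apply, ← hφ.map_conjTranspose,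
        conjTranspose_single, star_one]
    -- For `B = e v*` with a unit vector `e` one has `Bᴴ B = v v*`, so positivity of `φ` at `B` is
    -- nonnegativity of the quadratic form at `v`.
    · have h := hφ.nonneg (vecMulVec (Pi.single i₀ 1) (star v))
      convert h
      have : (vecMulVec (Pi.single i₀ (1 : ℂ)) (star v))ᴴ * vecMulVec (Pi.single i₀ 1) (star v)
          = ∑ i, ∑ j, (v i * star (v j)) • single i j (1 : ℂ) := by
        rw [matrix_eq_sum_single ((vecMulVec (Pi.single i₀ (1 : ℂ)) (star v))ᴴ * _)]
        refine Finset.sum_congr rfl fun i _ => Finset.sum_congr rfl fun j _ => ?_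
        rw [smul_single, smul_eq_mul, mul_one, mul_apply]
        congr 1
        rw [Finset.sum_eq_single i₀ (fun k _ hk => by simp [vecMulVec_apply, hk]) (by simp)]
        simp [vecMulVec_apply]
      rw [this]
      simp only [map_sum, map_smul, dotProduct, mulVec, of_apply, Finset.mul_sum, smul_eq_mul,
        Pi.star_apply]
      rw [Finset.sum_comm]
      refine Finset.sum_congr rfl fun i _ => Finset.sum_congr rfl fun j _ => ?_
      ring
  open scoped MatrixOrder Norms.L2Operator in
  obtain ⟨S, hS⟩ := CStarAlgebra.nonneg_iff_eq_star_mul_self.mp hR.nonneg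
  refine ⟨S, fun i j => ?_⟩
  rw [← star_eq_conjTranspose, ← hS, of_apply]

end IsState

theorem IsSiteState.isState {ρ : SiteOp →ₗ[ℂ] ℂ} (h : IsSiteState ρ) : IsState ρ := ⟨h.1, h.2⟩

/-! ### Positivity of the product functional. -/

/-- The product functional as a linear map. -/
noncomputable def prodState {d : ℕ} (ρ : SiteOp →ₗ[ℂ] ℂ) (L : ℕ) : BoxOp d L →ₗ[ℂ] ℂ where
  toFun := productState ρ L
  map_add' A B := by
    simp only [productState, Matrix.add_apply, add_mul, Finset.sum_add_distrib]
  map_smul' c A := by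
    simp only [productState, Matrix.smul_apply, smul_eq_mul, mul_assoc, Finset.mul_sum,
      RingHom.id_apply]

theorem prodState_siteTensor {d L : ℕ} (ρ : SiteOp →ₗ[ℂ] ℂ) (B : box d L → SiteOp) :
    prodState ρ L (siteTensor B) = ∏ x, ρ (B x) := productState_siteTensor ρ B

/-- With `ρ = tr (· Sᴴ S)` and `T = ⨂ S`, the product functional is `tr (· Tᴴ T)`; by cyclicity its
value at `Aᴴ A` is the trace of the square of `A Tᴴ`. -/
theorem isState_prodState {d L : ℕ} {ρ : SiteOp →ₗ[ℂ] ℂ} (hρ : IsState ρ) :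
    IsState (prodState ρ L : BoxOp d L →ₗ[ℂ] ℂ) := by
  refine ⟨fun A => ?_, productState_one ρ hρ.map_one⟩
  obtain ⟨S, hS⟩ := hρ.exists_density
  have h : ∀ A : BoxOp d L, prodState ρ L A =
      (A * ((siteTensor fun _ => S)ᴴ * siteTensor fun _ => S)).trace := by
    intro A
    rw [siteTensor_conjTranspose, siteTensor_mul]
    simp only [trace, diag, Matrix.mul_apply (M := A), siteTensor, of_apply]
    change productState ρ L A = _
    simp only [productState, hS]
  rw [h, ← mul_assoc, trace_mul_comm, ← mul_assoc, ← mul_assoc, mul_assoc]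
  have := (posSemidef_conjTranspose_mul_self (A * (siteTensor fun _ => S)ᴴ)).trace_nonneg
  rwa [conjTranspose_mul, conjTranspose_conjTranspose] at this

/-! ### One-site operators in the box: sums, means and variances. -/

open scoped Classical in
/-- The operator `u` at the site `x` and the identity at the other sites. -/
noncomputable def siteEmb {d L : ℕ} (x : box d L) (u : SiteOp) : BoxOp d L :=
  siteTensor fun y => if y = x then u else 1

section siteEmb

variable {d L : ℕ} (x y : box d L) (u v : SiteOp)

theorem siteEmb_mul : siteEmb x u * siteEmb x v = siteEmb x (u * v) := by
  rw [siteEmb, siteEmb, siteTensor_mul, siteEmb]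
  congr 1
  funext y
  split_ifs <;> simp

theorem siteEmb_one : siteEmb x 1 = 1 := by simp [siteEmb, siteTensor_one]

theorem siteEmb_add : siteEmb x (u + v) = siteEmb x u + siteEmb x v := by
  refine (siteTensor_add x ?_ ?_ ?_).symm <;> simp +contextual

theorem siteEmb_smul (c : ℂ) : siteEmb x (c • u) = c • siteEmb x u := by
  classical
  ext σ τ
  simp only [siteEmb, siteTensor, Matrix.of_apply, Matrix.smul_apply]
  rw [Fintype.prod_eq_mul_prod_compl x, Fintype.prod_eq_mul_prod_compl x (f := fun y =>
    (if y = x then u else 1 : SiteOp) (σ y) (τ y)), smul_eq_mul, ← mul_assoc]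
  congr 1
  · simp
  · refine Finset.prod_congr rfl fun y hy => ?_
    rw [if_neg (by simpa using hy), if_neg (by simpa using hy)]

theorem siteEmb_sub : siteEmb x (u - v) = siteEmb x u - siteEmb x v := by
  have := siteEmb_add x (u - v) v
  rw [sub_add_cancel] at this
  exact eq_sub_of_add_eq this.symm

theorem siteEmb_conjTranspose : (siteEmb x u)ᴴ = siteEmb x uᴴ := by
  rw [siteEmb, siteTensor_conjTranspose, siteEmb]
  congr 1
  funext y
  split_ifs <;> simp

variable {x y} in
theorem siteEmb_commute (h : x ≠ y) : Commute (siteEmb x u) (siteEmb y v) := by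
  rw [Commute, SemiconjBy, siteEmb, siteEmb, siteTensor_mul, siteTensor_mul]
  congr 1
  funext z
  by_cases h1 : z = x
  · subst h1; simp [h]
  · simp [h1]

/-- The parity strings square to one, so quadratic expressions at one site carry no string and
behave like spin operators. -/
theorem siteEmb_eq_stringTensor_mul : siteEmb x (u * v) = stringTensor x u * stringTensor x v :=
  (stringTensor_mul_self x u v).symm

theorem siteEmb_diagonal (f : Fin 4 → ℂ) :
    siteEmb x (Matrix.diagonal f) = Matrix.diagonal fun σ => f (σ x) := by
  classical
  ext σ τ
  simp only [siteEmb, siteTensor, Matrix.of_apply]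
  by_cases h : σ = τ
  · subst h
    rw [Matrix.diagonal_apply_eq, Fintype.prod_eq_single x (fun y hy => by simp [hy])]
    simp
  · rw [Matrix.diagonal_apply_ne _ h]
    obtain ⟨y, hy⟩ := Function.ne_iff.mp h
    refine Finset.prod_eq_zero (Finset.mem_univ y) ?_
    split_ifs
    · exact Matrix.diagonal_apply_ne _ hy
    · exact Matrix.one_apply_ne hy

variable {ρ : SiteOp →ₗ[ℂ] ℂ}

theorem prodState_siteEmb (hρ : ρ 1 = 1) : prodState ρ L (siteEmb x u) = ρ u := by
  rw [siteEmb, prodState_siteTensor, Fintype.prod_eq_single x (fun y hy => by simp [hy, hρ])]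
  simp

variable {x y} in
theorem prodState_siteEmb_mul (hρ : ρ 1 = 1) (h : x ≠ y) :
    prodState ρ L (siteEmb x u * siteEmb y v) = ρ u * ρ v := by
  rw [siteEmb, siteEmb, siteTensor_mul, prodState_siteTensor, Fintype.prod_eq_mul x y h]
  · simp [h, h.symm]
  · intro z hz
    simp [hz.1, hz.2, hρ]

end siteEmb

/-- The sum of the copies of `u` at all sites of the box. -/
noncomputable def total (d L : ℕ) (u : SiteOp) : BoxOp d L := ∑ x, siteEmb x u

section total

variable {d L : ℕ} (u v : SiteOp)

theorem total_sub : total d L (u - v) = total d L u - total d L v := by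
  simp only [total, siteEmb_sub, Finset.sum_sub_distrib]

theorem total_smul (c : ℂ) : total d L (c • u) = c • total d L u := by
  simp only [total, siteEmb_smul, Finset.smul_sum]

theorem total_one : total d L 1 = ((box d L).card : ℂ) • 1 := by
  simp only [total, siteEmb_one, Finset.sum_const, Finset.card_univ, Fintype.card_coe, Nat.cast_smul_eq_nsmul]

theorem total_conjTranspose : (total d L u)ᴴ = total d L uᴴ := by
  simp only [total, conjTranspose_sum, siteEmb_conjTranspose]

/-- Operators at distinct sites commute, so only the terms with equal sites survive: `total`
respects commutators. -/
theorem total_lie : total d L u * total d L v - total d L v * total d L u =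
    total d L (u * v - v * u) := by
  simp only [total, Finset.sum_mul_sum]
  rw [Finset.sum_comm (f := fun x y => siteEmb x v * siteEmb y u), ← Finset.sum_sub_distrib]
  refine Finset.sum_congr rfl fun x _ => ?_
  rw [← Finset.sum_sub_distrib, Finset.sum_eq_single x]
  · rw [siteEmb_sub, siteEmb_mul, siteEmb_mul]
  · intro y _ hy
    rw [siteEmb_commute u v hy.symm, sub_self]
  · simp

variable {ρ : SiteOp →ₗ[ℂ] ℂ}

theorem prodState_total (hρ : ρ 1 = 1) : prodState ρ L (total d L u) = (box d L).card * ρ u := by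
  simp [total, prodState_siteEmb _ _ hρ]

/-- Distinct sites are independent in the product state; centring `u` kills the off-diagonal terms,
leaving `|Λ|` terms out of `|Λ|²`. -/
theorem prodState_total_mul (hρ : ρ 1 = 1) (hu : ρ u = 0) :
    prodState ρ L (total d L u * total d L v) = (box d L).card * ρ (u * v) := by
  rw [total, total, Finset.sum_mul_sum, map_sum]
  simp only [map_sum]
  have : ∀ x : box d L, ∑ y, prodState ρ L (siteEmb x u * siteEmb y v) = ρ (u * v) := by
    intro x
    rw [Finset.sum_eq_single x]
    · rw [siteEmb_mul, prodState_siteEmb _ _ hρ]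
    · intro y _ hy
      rw [prodState_siteEmb_mul _ _ hρ hy.symm, hu, zero_mul]
    · simp
  rw [Finset.sum_congr rfl fun x _ => this x, Finset.sum_const, Finset.card_univ,
    Fintype.card_coe, nsmul_eq_mul]

end total

theorem card_box (d L : ℕ) : (box d L).card = (2 * L + 1) ^ d := by
  simp only [box, Fintype.card_piFinset, Int.card_Icc, Finset.prod_const, Finset.card_univ,
    Fintype.card_fin]
  congr 1
  omega

theorem card_box_ne_zero (d L : ℕ) : ((box d L).card : ℂ) ≠ 0 := by
  rw [card_box]; positivity

/-- The mean of the copies of `u` at all sites of the box. -/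
noncomputable def mean (d L : ℕ) (u : SiteOp) : BoxOp d L := ((box d L).card : ℂ)⁻¹ • total d L u

theorem mean_conjTranspose {d L : ℕ} (u : SiteOp) : (mean d L u)ᴴ = mean d L uᴴ := by
  simp [mean, conjTranspose_smul, total_conjTranspose]

theorem mean_sub_smul_one {d L : ℕ} (u : SiteOp) (z : ℂ) :
    mean d L u - z • 1 = mean d L (u - z • 1) := by
  rw [mean, mean, total_sub, total_smul, total_one, smul_sub, smul_comm z, smul_smul,
    inv_mul_cancel₀ (card_box_ne_zero d L), one_smul]

theorem prodState_mean {d L : ℕ} {ρ : SiteOp →ₗ[ℂ] ℂ} (hρ : ρ 1 = 1) (u : SiteOp) :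
    prodState ρ L (mean d L u) = ρ u := by
  rw [mean, map_smul, prodState_total _ hρ, smul_eq_mul, inv_mul_cancel_left₀ (card_box_ne_zero d L)]

/-- The variance of a mean in the product state. -/
theorem prodState_variance {d L : ℕ} {ρ : SiteOp →ₗ[ℂ] ℂ} (hρ : IsState ρ) (u : SiteOp) :
    prodState ρ L ((mean d L u - ρ u • 1)ᴴ * (mean d L u - ρ u • 1)) =
      ((box d L).card : ℂ)⁻¹ * ρ ((u - ρ u • 1)ᴴ * (u - ρ u • 1)) := by
  have h : ρ (u - ρ u • 1)ᴴ = 0 := by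
    rw [hρ.map_conjTranspose, map_sub, map_smul, hρ.map_one]; simp
  rw [mean_sub_smul_one, mean_conjTranspose, mean, mean, smul_mul_smul_comm, map_smul,
    prodState_total_mul _ _ hρ.map_one h, smul_eq_mul, mul_assoc,
    inv_mul_cancel_left₀ (card_box_ne_zero d L)]

/-! ### Heisenberg dynamics of a finite matrix algebra. -/

section Heisenberg

variable {ι : Type*} [Fintype ι] [DecidableEq ι] {H : Matrix ι ι ℂ}

/-- The Heisenberg dynamics generated by `H`. -/
noncomputable def heisenberg (H : Matrix ι ι ℂ) (t : ℝ) : Matrix ι ι ℂ →ₗ[ℂ] Matrix ι ι ℂ where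
  toFun A := NormedSpace.exp ((Complex.I * (t : ℂ)) • H) * A *
    NormedSpace.exp (-((Complex.I * (t : ℂ)) • H))
  map_add' A B := by rw [mul_add, add_mul]
  map_smul' c A := by rw [mul_smul_comm, smul_mul_assoc, RingHom.id_apply]

theorem heisenberg_apply (H : Matrix ι ι ℂ) (t : ℝ) (A : Matrix ι ι ℂ) :
    heisenberg H t A = NormedSpace.exp ((Complex.I * (t : ℂ)) • H) * A *
      NormedSpace.exp (-((Complex.I * (t : ℂ)) • H)) := rfl

theorem exp_mul_exp_neg (A : Matrix ι ι ℂ) : NormedSpace.exp A * NormedSpace.exp (-A) = 1 := by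
  rw [← Matrix.exp_add_of_commute _ _ (Commute.refl A).neg_right, add_neg_cancel,
    NormedSpace.exp_zero]

theorem exp_neg_mul_exp (A : Matrix ι ι ℂ) : NormedSpace.exp (-A) * NormedSpace.exp A = 1 := by
  simpa using exp_mul_exp_neg (-A)

theorem exp_I_smul_conjTranspose (hH : H.IsHermitian) (t : ℝ) :
    (NormedSpace.exp ((Complex.I * (t : ℂ)) • H))ᴴ =
      NormedSpace.exp (-((Complex.I * (t : ℂ)) • H)) := by
  rw [← Matrix.exp_conjTranspose, conjTranspose_smul, hH.eq]
  simp

theorem heisenberg_mul (t : ℝ) (A B : Matrix ι ι ℂ) :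
    heisenberg H t (A * B) = heisenberg H t A * heisenberg H t B := by
  simp only [heisenberg_apply, mul_assoc]
  rw [← mul_assoc (NormedSpace.exp (-_)) (NormedSpace.exp _), exp_neg_mul_exp, one_mul]

theorem heisenberg_conjTranspose (hH : H.IsHermitian) (t : ℝ) (A : Matrix ι ι ℂ) :
    heisenberg H t Aᴴ = (heisenberg H t A)ᴴ := by
  simp only [heisenberg_apply, conjTranspose_mul, ← exp_I_smul_conjTranspose hH,
    conjTranspose_conjTranspose, mul_assoc]

/-- `A` is an eigenoperator of the commutator with `H`, with a conserved operator `Ω` as eigenvalue.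
Moving `A` through `exp(-itH)` produces `exp(-it(H - Ω))`, and commutation of `H` and `Ω` leaves
`exp(itΩ)`. -/
theorem heisenberg_of_semiconjBy {A Ω : Matrix ι ι ℂ} (t : ℝ) (h : SemiconjBy A H (H - Ω))
    (hΩ : Commute H Ω) :
    heisenberg H t A = NormedSpace.exp ((Complex.I * (t : ℂ)) • Ω) * A := by
  have h1 : SemiconjBy A (-((Complex.I * (t : ℂ)) • H))
      (-((Complex.I * (t : ℂ)) • H) + (Complex.I * (t : ℂ)) • Ω) := by
    have := (h.smul_right (Complex.I * (t : ℂ))).neg_right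
    rwa [smul_sub, neg_sub, sub_eq_neg_add] at this
  have h2 : SemiconjBy A (NormedSpace.exp (-((Complex.I * (t : ℂ)) • H)))
      (NormedSpace.exp (-((Complex.I * (t : ℂ)) • H) + (Complex.I * (t : ℂ)) • Ω)) := by
    open scoped Norms.Operator in exact h1.exp_right
  rw [heisenberg_apply, mul_assoc, h2.eq, Matrix.exp_add_of_commute _ _
    (((hΩ.smul_left _).smul_right _).neg_left), ← mul_assoc, ← mul_assoc, exp_mul_exp_neg, one_mul]

theorem heisenberg_of_commute {A : Matrix ι ι ℂ} (t : ℝ) (h : Commute A H) :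
    heisenberg H t A = A := by
  rw [heisenberg_of_semiconjBy (Ω := 0) t (by simpa using! h) (Commute.zero_right _), smul_zero,
    NormedSpace.exp_zero, one_mul]

theorem heisenberg_one (t : ℝ) : heisenberg H t 1 = 1 := heisenberg_of_commute t (.one_left _)

theorem heisenberg_zero (A : Matrix ι ι ℂ) : heisenberg H 0 A = A := by
  simp [heisenberg_apply]

-- The commutator is placed inside `heisenberg`, so that the derivative is again an expectation in
-- the evolved functional.
open scoped Norms.Operator in
theorem hasDerivAt_heisenberg_apply (H : Matrix ι ι ℂ) (φ : Matrix ι ι ℂ →ₗ[ℂ] ℂ)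
    (A : Matrix ι ι ℂ) (t : ℝ) :
    HasDerivAt (fun s : ℝ => φ (heisenberg H s A))
      (φ (heisenberg H t (Complex.I • (H * A - A * H)))) t := by
  have h1 : HasDerivAt (fun s : ℝ => NormedSpace.exp ((Complex.I * (s : ℂ)) • H))
      (NormedSpace.exp ((Complex.I * (t : ℂ)) • H) * (Complex.I • H)) t := by
    have := hasDerivAt_exp_smul_const (𝕂 := ℝ) (Complex.I • H) t
    have e : ∀ s : ℝ, (Complex.I * (s : ℂ)) • H = s • (Complex.I • H) := fun s => by
      rw [mul_comm, mul_smul, Complex.coe_smul]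
    simp only [e]
    exact this
  have h2 : HasDerivAt (fun s : ℝ => NormedSpace.exp (-((Complex.I * (s : ℂ)) • H)))
      (-(Complex.I • H) * NormedSpace.exp (-((Complex.I * (t : ℂ)) • H))) t := by
    have := hasDerivAt_exp_smul_const' (𝕂 := ℝ) (-(Complex.I • H)) t
    have e : ∀ s : ℝ, -((Complex.I * (s : ℂ)) • H) = s • (-(Complex.I • H)) := fun s => by
      rw [mul_comm, mul_smul, Complex.coe_smul, smul_neg]
    simp only [e]
    exact this
  have h3 := (h1.mul_const A).mul h2
  have h4 := ((φ.restrictScalars ℝ).toContinuousLinearMap.hasFDerivAt.comp_hasDerivAt t h3)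
  refine h4.congr_deriv ?_
  change φ _ = φ _
  rw [heisenberg_apply]
  congr 1
  simp only [smul_mul_assoc, mul_smul_comm, mul_sub, sub_mul, neg_mul, mul_neg, mul_assoc,
    smul_sub]
  exact (sub_eq_add_neg _ _).symm

theorem IsState.comp_heisenberg {φ : Matrix ι ι ℂ →ₗ[ℂ] ℂ} (hφ : IsState φ) (hH : H.IsHermitian)
    (t : ℝ) : IsState (φ ∘ₗ heisenberg H t) := by
  refine ⟨fun A => ?_, ?_⟩
  · rw [LinearMap.comp_apply, heisenberg_mul, heisenberg_conjTranspose hH]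
    exact hφ.nonneg _
  · rw [LinearMap.comp_apply, heisenberg_one, hφ.map_one]

/-- The difference of the two diagonal matrices is the square of the diagonal matrix of `√(g - f)`.
-/
theorem IsState.map_diagonal_mono {φ : Matrix ι ι ℂ →ₗ[ℂ] ℂ} (hφ : IsState φ) {f g : ι → ℝ}
    (h : f ≤ g) : (φ (diagonal fun i => (f i : ℂ))).re ≤ (φ (diagonal fun i => (g i : ℂ))).re := by
  have h1 := (Complex.nonneg_iff.mp (hφ.nonneg (diagonal fun i => (√(g i - f i) : ℂ)))).1
  rw [diagonal_conjTranspose, diagonal_mul_diagonal] at h1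
  have h2 : (diagonal fun i => star (fun i => (√(g i - f i) : ℂ)) i * (√(g i - f i) : ℂ)) =
      (diagonal fun i => (g i : ℂ)) - diagonal fun i => (f i : ℂ) := by
    rw [diagonal_sub]
    congr 1
    funext i
    rw [Pi.star_apply, Complex.star_def, Complex.conj_ofReal, ← Complex.ofReal_mul,
      Real.mul_self_sqrt (sub_nonneg.mpr (h i)), Complex.ofReal_sub]
  rw [h2, map_sub, Complex.sub_re] at h1
  linarith

end Heisenberg

/-! ### Pseudospin algebra and the mean-field form of the Hamiltonian. -/

/-- The one-site pair annihilation operator `a↓ a↑`. -/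
noncomputable def pair : SiteOp := siteAnn Spin.down * siteAnn Spin.up

/-- The one-site Hamiltonian without the pairing term. -/
noncomputable def siteHam (mu h lam : ℝ) : SiteOp :=
  ((2 * lam : ℝ) : ℂ) • (siteNum Spin.up * siteNum Spin.down)
    - (mu : ℂ) • (siteNum Spin.up + siteNum Spin.down)
    - (h : ℂ) • (siteNum Spin.up - siteNum Spin.down)

/-- The number of particles at one site minus one. -/
noncomputable def siteExcess : SiteOp := siteNum Spin.up + siteNum Spin.down - 1

theorem siteNum_up : siteNum Spin.up = diagonal ![0, 1, 0, 1] := by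
  ext i j
  fin_cases i <;> fin_cases j <;>
    simp [siteNum, siteAnn, Matrix.mul_apply, Fin.sum_univ_four]

theorem siteNum_down : siteNum Spin.down = diagonal ![0, 0, 1, 1] := by
  ext i j
  fin_cases i <;> fin_cases j <;>
    simp [siteNum, siteAnn, Matrix.mul_apply, Fin.sum_univ_four]

theorem pair_eq : pair = single 0 3 1 := by
  ext i j
  fin_cases i <;> fin_cases j <;>
    simp [pair, siteAnn, Matrix.mul_apply, Fin.sum_univ_four]

theorem siteExcess_eq : siteExcess = diagonal fun i => ((![-1, 0, 0, 1] i : ℝ) : ℂ) := by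
  rw [siteExcess, siteNum_up, siteNum_down, diagonal_add, ← diagonal_one, diagonal_sub]
  congr 1
  funext i
  fin_cases i <;> simp

theorem siteHam_eq (mu h lam : ℝ) :
    siteHam mu h lam = diagonal ![0, -(mu + h : ℂ), -(mu - h : ℂ), 2 * lam - 2 * mu] := by
  rw [siteHam, siteNum_up, siteNum_down, diagonal_mul_diagonal, diagonal_add, diagonal_sub,
    ← diagonal_smul, ← diagonal_smul, ← diagonal_smul, diagonal_sub, diagonal_sub]
  congr 1
  funext i
  fin_cases i <;> simp <;> ring

theorem diagonal_mul_pair (f : Fin 4 → ℂ) : diagonal f * pair = f 0 • pair := by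
  ext i j
  rw [diagonal_mul, pair_eq, Matrix.smul_apply, smul_eq_mul, single_apply]
  split_ifs with h
  · rw [h.1]
  · simp

theorem pair_mul_diagonal (f : Fin 4 → ℂ) : pair * diagonal f = f 3 • pair := by
  ext i j
  rw [mul_diagonal, pair_eq, Matrix.smul_apply, smul_eq_mul, single_apply]
  split_ifs with h
  · rw [h.2, mul_comm]
  · simp

/-- The `su(2)` relation of the pseudospin formed by vacuum and doubly occupied site. It is the
source of the density dependence of the frequency. -/
theorem pair_lie : pairᴴ * pair - pair * pairᴴ = siteExcess := by
  rw [pair_eq, siteExcess_eq, conjTranspose_single, single_mul_single_same, single_mul_single_same]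
  ext i j
  fin_cases i <;> fin_cases j <;> simp [single]

section

variable {d L : ℕ}

theorem num_eq (x : box d L) (s : Spin) : num x s = siteEmb x (siteNum s) := by
  rw [num, cre_eq, ann_eq, siteNum, siteEmb_eq_stringTensor_mul]

theorem ann_mul_ann (x : box d L) : ann x Spin.down * ann x Spin.up = siteEmb x pair := by
  rw [ann_eq, ann_eq, pair, siteEmb_eq_stringTensor_mul]

theorem cre_mul_cre (x : box d L) : cre x Spin.up * cre x Spin.down = siteEmb x pairᴴ := by
  rw [cre_eq, cre_eq, pair, conjTranspose_mul, siteEmb_eq_stringTensor_mul]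

theorem onSite_eq (mu h lam : ℝ) (x : box d L) :
    onSite mu h lam x = siteEmb x (siteHam mu h lam) := by
  simp only [onSite, siteHam, siteEmb_sub, siteEmb_smul, siteEmb_add, num_eq, siteEmb_mul]

theorem hamiltonian_eq (mu h lam gam : ℝ) :
    hamiltonian d L mu h lam gam =
      total d L (siteHam mu h lam) - (gam : ℂ) • (total d L pairᴴ * mean d L pair) := by
  simp only [hamiltonian, onSite_eq, cre_mul_cre, ann_mul_ann, ← Finset.sum_mul_sum]
  rw [mean, mul_smul_comm, smul_smul]
  simp [total, div_eq_mul_inv]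

theorem total_mul_mean (u v : SiteOp) : total d L u * mean d L v = mean d L u * total d L v := by
  simp [mean]

theorem total_mean_lie (u v : SiteOp) :
    total d L u * mean d L v - mean d L v * total d L u = mean d L (u * v - v * u) := by
  simp only [mean, mul_smul_comm, smul_mul_assoc, ← smul_sub, total_lie]

theorem mean_smul (c : ℂ) (u : SiteOp) : mean d L (c • u) = c • mean d L u := by
  simp only [mean, total_smul, smul_comm c]

theorem isHermitian_hamiltonian (mu h lam gam : ℝ) :
    (hamiltonian d L mu h lam gam).IsHermitian := by
  have h1 : (siteHam mu h lam)ᴴ = siteHam mu h lam := by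
    rw [siteHam_eq, diagonal_conjTranspose]
    congr 1
    funext i
    fin_cases i <;> simp
  rw [IsHermitian, hamiltonian_eq, conjTranspose_sub, conjTranspose_smul, conjTranspose_mul,
    total_conjTranspose, total_conjTranspose, mean_conjTranspose, conjTranspose_conjTranspose, h1,
    total_mul_mean]
  simp

/-- Sums of diagonal one-site operators are conserved. -/
theorem commute_mean_hamiltonian (mu h lam gam : ℝ) (f : Fin 4 → ℝ) :
    Commute (mean d L (diagonal fun i => (f i : ℂ))) (hamiltonian d L mu h lam gam) := by
  refine Commute.smul_left ?_ _
  set u : SiteOp := diagonal fun i => (f i : ℂ) with hu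
  -- `pair` and `pairᴴ` have opposite weights under a diagonal operator, which cancel in the pairing
  -- term.
  have hc : u * pair - pair * u = (f 0 - f 3 : ℂ) • pair := by
    rw [hu, diagonal_mul_pair, pair_mul_diagonal, sub_smul]
  have hc' : u * pairᴴ - pairᴴ * u = -((f 0 - f 3 : ℂ) • pairᴴ) := by
    have := congrArg conjTranspose hc
    have hu' : uᴴ = u := by
      rw [hu, diagonal_conjTranspose]
      congr 1
      funext i
      simp
    rw [conjTranspose_sub, conjTranspose_mul, conjTranspose_mul, hu', conjTranspose_smul] at this
    rw [← neg_sub, this]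
    simp
  have h1 : total d L u * total d L (siteHam mu h lam) =
      total d L (siteHam mu h lam) * total d L u := by
    rw [← sub_eq_zero, total_lie, siteHam_eq, hu, (commute_diagonal _ _).eq, sub_self]
    simpa using total_smul (d := d) (L := L) 0 0
  have h2 : total d L u * total d L pairᴴ =
      total d L pairᴴ * total d L u - (f 0 - f 3 : ℂ) • total d L pairᴴ := by
    rw [sub_eq_add_neg, ← sub_eq_iff_eq_add', total_lie, hc', ← neg_smul, total_smul,
      neg_smul]
  have h3 : total d L u * mean d L pair =
      mean d L pair * total d L u + (f 0 - f 3 : ℂ) • mean d L pair := by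
    rw [← sub_eq_iff_eq_add', total_mean_lie, hc, mean_smul]
  rw [Commute, SemiconjBy, hamiltonian_eq, mul_sub, sub_mul, h1, mul_smul_comm, smul_mul_assoc,
    ← mul_assoc, h2, sub_mul, mul_assoc, h3, mul_add, mul_assoc, smul_mul_assoc, mul_smul_comm,
    add_sub_cancel_right]

/-- The operator of the precession frequency of the pair field. -/
noncomputable def freq (d L : ℕ) (mu lam gam : ℝ) : BoxOp d L :=
  ((2 * (mu - lam) : ℝ) : ℂ) • 1 - (gam : ℂ) • mean d L siteExcess

theorem commute_hamiltonian_freq (mu h lam gam : ℝ) :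
    Commute (hamiltonian d L mu h lam gam) (freq d L mu lam gam) := by
  refine ((Commute.one_right _).smul_right _).sub_right (Commute.smul_right ?_ _)
  rw [siteExcess_eq]
  exact (commute_mean_hamiltonian mu h lam gam _).symm

/-- This is `[H, P] = Ω P`. The on-site part contributes the energy difference of vacuum and doubly
occupied site, in which `h` drops out; the pairing term contributes `-γ mean [p*, p] P`. -/
theorem semiconjBy_mean_pair (mu h lam gam : ℝ) :
    SemiconjBy (mean d L pair) (hamiltonian d L mu h lam gam)
      (hamiltonian d L mu h lam gam - freq d L mu lam gam) := by
  have h1 : total d L (siteHam mu h lam) * mean d L pair =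
      mean d L pair * total d L (siteHam mu h lam) +
        ((2 * (mu - lam) : ℝ) : ℂ) • mean d L pair := by
    rw [← sub_eq_iff_eq_add', total_mean_lie, siteHam_eq, diagonal_mul_pair, pair_mul_diagonal,
      ← sub_smul, mean_smul]
    congr 1
    simp
    ring
  have h2 : total d L pairᴴ * mean d L pair =
      mean d L pair * total d L pairᴴ + mean d L siteExcess := by
    rw [← sub_eq_iff_eq_add', total_mean_lie, pair_lie]
  rw [SemiconjBy, sub_mul, eq_sub_iff_add_eq, hamiltonian_eq, freq]
  simp only [mul_sub, sub_mul, h1, mul_smul_comm, smul_mul_assoc, one_mul]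
  nth_rewrite 2 [h2]
  rw [add_mul, smul_add, mul_assoc]
  abel

theorem heisenberg_mean_pair (mu h lam gam t : ℝ) :
    heisenberg (hamiltonian d L mu h lam gam) t (mean d L pair) =
      NormedSpace.exp ((Complex.I * (t : ℂ)) • freq d L mu lam gam) * mean d L pair :=
  heisenberg_of_semiconjBy t (semiconjBy_mean_pair mu h lam gam)
    (commute_hamiltonian_freq mu h lam gam)

end

/-! ### Permutation invariance of the Hamiltonian and of the product state. -/

section permutation

variable {d L : ℕ}

/-- The action of the permutations of the sites on operators that are even at every site. -/
noncomputable def permute (π : Equiv.Perm (box d L)) : BoxOp d L ≃ₐ[ℂ] BoxOp d L :=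
  Matrix.reindexAlgEquiv ℂ ℂ (π.arrowCongr (Equiv.refl (Fin 4)))

theorem permute_apply (π : Equiv.Perm (box d L)) (A : BoxOp d L) (σ τ : box d L → Fin 4) :
    permute π A σ τ = A (σ ∘ π) (τ ∘ π) := rfl

theorem permute_siteEmb (π : Equiv.Perm (box d L)) (x : box d L) (u : SiteOp) :
    permute π (siteEmb x u) = siteEmb (π x) u := by
  ext σ τ
  rw [permute_apply]
  simp only [siteEmb, siteTensor, of_apply, Function.comp_apply]
  refine Fintype.prod_equiv π _ _ fun y => ?_
  simp only [π.injective.eq_iff]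

theorem permute_total (π : Equiv.Perm (box d L)) (u : SiteOp) :
    permute π (total d L u) = total d L u := by
  rw [total, map_sum]
  exact Fintype.sum_equiv π _ _ fun x => permute_siteEmb π x u

theorem permute_hamiltonian (π : Equiv.Perm (box d L)) (mu h lam gam : ℝ) :
    permute π (hamiltonian d L mu h lam gam) = hamiltonian d L mu h lam gam := by
  simp only [hamiltonian_eq, mean, map_sub, map_smul, map_mul, permute_total]

open scoped Norms.Operator in
theorem permute_exp (π : Equiv.Perm (box d L)) (A : BoxOp d L) :
    permute π (NormedSpace.exp A) = NormedSpace.exp (permute π A) :=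
  NormedSpace.map_exp (permute π) (permute π).toLinearEquiv.toLinearMap.continuous_of_finiteDimensional A

theorem permute_heisenberg (π : Equiv.Perm (box d L)) (mu h lam gam t : ℝ) (A : BoxOp d L) :
    permute π (heisenberg (hamiltonian d L mu h lam gam) t A) =
      heisenberg (hamiltonian d L mu h lam gam) t (permute π A) := by
  simp only [heisenberg_apply, map_mul, permute_exp, map_neg, map_smul, permute_hamiltonian]

theorem prodState_permute (ρ : SiteOp →ₗ[ℂ] ℂ) (π : Equiv.Perm (box d L)) (A : BoxOp d L) :
    prodState ρ L (permute π A) = prodState ρ L A := by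
  change productState ρ L _ = productState ρ L _
  let e : (box d L → Fin 4) ≃ (box d L → Fin 4) := (π.arrowCongr (Equiv.refl (Fin 4))).symm
  refine Fintype.sum_equiv e _ _ fun σ => Fintype.sum_equiv e _ _ fun τ => ?_
  rw [permute_apply]
  congr 1
  exact (Fintype.prod_equiv π _ _ fun x => rfl).symm

end permutation

/-! ### The time-evolved product state. -/

/-- The expectation at time `t` in the system in the box, started in the product state. -/
noncomputable def evolvedState (d L : ℕ) (mu h lam gam : ℝ) (ρ : SiteOp →ₗ[ℂ] ℂ) (t : ℝ) :
    BoxOp d L →ₗ[ℂ] ℂ :=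
  prodState ρ L ∘ₗ heisenberg (hamiltonian d L mu h lam gam) t

section evolved

variable {d L : ℕ} {mu h lam gam t : ℝ} {ρ : SiteOp →ₗ[ℂ] ℂ}

theorem isState_evolvedState (hρ : IsState ρ) : IsState (evolvedState d L mu h lam gam ρ t) :=
  (isState_prodState hρ).comp_heisenberg (isHermitian_hamiltonian mu h lam gam) t

/-- Swapping two sites changes neither the Hamiltonian nor the initial state, so all sites have
equal expectations, and control of means becomes control at one site. -/
theorem evolvedState_siteEmb (x : box d L) (u : SiteOp) :
    evolvedState d L mu h lam gam ρ t (siteEmb x u) =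
      evolvedState d L mu h lam gam ρ t (mean d L u) := by
  have h1 : ∀ y, evolvedState d L mu h lam gam ρ t (siteEmb y u) =
      evolvedState d L mu h lam gam ρ t (siteEmb x u) := by
    classical
    intro y
    simp only [evolvedState, LinearMap.comp_apply]
    rw [← prodState_permute ρ (Equiv.swap y x), permute_heisenberg, permute_siteEmb,
      Equiv.swap_apply_left]
  rw [mean, total, map_smul, map_sum, Finset.sum_congr rfl fun y _ => h1 y, Finset.sum_const,
    Finset.card_univ, Fintype.card_coe, nsmul_eq_mul, smul_eq_mul,
    inv_mul_cancel_left₀ (card_box_ne_zero d L)]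

/-- The expectations of diagonal one-site operators do not depend on time. -/
theorem evolvedState_siteEmb_diagonal (hρ : ρ 1 = 1) (x : box d L) (f : Fin 4 → ℝ) :
    evolvedState d L mu h lam gam ρ t (siteEmb x (diagonal fun i => (f i : ℂ))) =
      ρ (diagonal fun i => (f i : ℂ)) := by
  rw [evolvedState_siteEmb, evolvedState, LinearMap.comp_apply,
    heisenberg_of_commute t (commute_mean_hamiltonian mu h lam gam f), prodState_mean hρ]

end evolved

theorem mean_diagonal {d L : ℕ} (f : Fin 4 → ℝ) : mean d L (diagonal fun i => (f i : ℂ)) =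
    diagonal fun σ => ((((box d L).card : ℝ)⁻¹ * ∑ x, f (σ x) : ℝ) : ℂ) := by
  simp only [mean, total, siteEmb_diagonal]
  ext σ τ
  rw [Matrix.smul_apply, Matrix.sum_apply]
  by_cases h : σ = τ
  · subst h
    simp
  · simp [diagonal_apply_ne _ h]

/-! ### The Cooper field and its fluctuations. -/

/-- The phase velocity of the Cooper field. -/
noncomputable def phaseVelocity (mu lam gam : ℝ) (ρ : SiteOp →ₗ[ℂ] ℂ) : ℝ :=
  2 * (mu - lam) - gam * (ρ siteExcess).re

/-- The Cooper field at time `t`. -/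
noncomputable def field (mu lam gam : ℝ) (ρ : SiteOp →ₗ[ℂ] ℂ) (t : ℝ) : ℂ :=
  Complex.exp (Complex.I * (t * phaseVelocity mu lam gam ρ : ℝ)) * ρ pair

/-- The constant modulus gives the effective ODE a Lipschitz constant independent of time. -/
theorem norm_field (mu lam gam : ℝ) (ρ : SiteOp →ₗ[ℂ] ℂ) (t : ℝ) :
    ‖field mu lam gam ρ t‖ = ‖ρ pair‖ := by
  rw [field, norm_mul, mul_comm Complex.I, Complex.norm_exp_ofReal_mul_I, one_mul]

theorem coe_re_map_siteExcess {ρ : SiteOp →ₗ[ℂ] ℂ} (hρ : IsState ρ) :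
    ((ρ siteExcess).re : ℂ) = ρ siteExcess := by
  have h : siteExcessᴴ = siteExcess := by
    rw [siteExcess_eq, diagonal_conjTranspose]
    congr 1
    funext i
    simp
  have := hρ.map_conjTranspose siteExcess
  rw [h] at this
  exact Complex.conj_eq_iff_re.mp this.symm

theorem exp_I_mul_sub_norm_sq_le (t a b : ℝ) :
    ‖Complex.exp (Complex.I * (t * a : ℝ)) - Complex.exp (Complex.I * (t * b : ℝ))‖ ^ 2 ≤
      t ^ 2 * (a - b) ^ 2 := by
  have h : Complex.exp (Complex.I * (t * a : ℝ)) - Complex.exp (Complex.I * (t * b : ℝ)) =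
      Complex.exp ((t * b : ℝ) * Complex.I) *
        (Complex.exp (Complex.I * (t * (a - b) : ℝ)) - 1) := by
    rw [mul_sub, ← Complex.exp_add, mul_one, mul_comm _ Complex.I, ← mul_add]
    push_cast
    ring_nf
  rw [h, norm_mul, Complex.norm_exp_ofReal_mul_I, one_mul, ← mul_pow, ← sq_abs (t * _)]
  gcongr
  exact Real.norm_exp_I_mul_ofReal_sub_one_le

/-- All operators here are diagonal in the occupation basis, so `|e^{ia} - e^{ib}| ≤ |a - b|` holds
eigenvalue by eigenvalue and reduces the phase error to the variance of the mean excess. -/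
theorem prodState_exp_freq_sub {d L : ℕ} {mu lam gam t : ℝ} {ρ : SiteOp →ₗ[ℂ] ℂ}
    (hρ : IsState ρ) (w : ℂ) (hw : w = Complex.exp (Complex.I * (t * phaseVelocity mu lam gam ρ : ℝ))) :
    (prodState ρ L ((NormedSpace.exp ((Complex.I * (t : ℂ)) • freq d L mu lam gam) - w • 1)ᴴ *
      (NormedSpace.exp ((Complex.I * (t : ℂ)) • freq d L mu lam gam) - w • 1))).re ≤
      t ^ 2 * (gam ^ 2 * (((box d L).card : ℝ)⁻¹ *
        (ρ ((siteExcess - ρ siteExcess • 1)ᴴ * (siteExcess - ρ siteExcess • 1))).re)) := by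
  obtain ⟨g, hg⟩ : ∃ g : (box d L → Fin 4) → ℝ,
      mean d L siteExcess = diagonal fun σ => (g σ : ℂ) :=
    ⟨_, by rw [siteExcess_eq, mean_diagonal]⟩
  have hω : freq d L mu lam gam =
      diagonal fun σ => ((2 * (mu - lam) - gam * g σ : ℝ) : ℂ) := by
    rw [freq, hg, ← diagonal_one, ← diagonal_smul, ← diagonal_smul, diagonal_sub]
    congr 1
    funext σ
    simp
  have hexp : NormedSpace.exp ((Complex.I * (t : ℂ)) • freq d L mu lam gam) - w • 1 =
      diagonal fun σ => Complex.exp (Complex.I * (t * (2 * (mu - lam) - gam * g σ) : ℝ)) - w := by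
    rw [hω, ← diagonal_smul, exp_diagonal, ← diagonal_one, ← diagonal_smul, diagonal_sub]
    congr 1
    funext σ
    rw [Pi.coe_exp, ← Complex.exp_eq_exp_ℂ]
    simp [mul_assoc]
  have hvar := prodState_variance (d := d) (L := L) hρ siteExcess
  have hdiag : mean d L siteExcess - ρ siteExcess • 1 =
      diagonal fun σ => ((g σ - (ρ siteExcess).re : ℝ) : ℂ) := by
    rw [hg, ← diagonal_one, ← diagonal_smul, diagonal_sub]
    congr 1
    funext σ
    rw [Complex.ofReal_sub, coe_re_map_siteExcess hρ]
    simp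
  have hre : (((box d L).card : ℝ)⁻¹ *
        (ρ ((siteExcess - ρ siteExcess • 1)ᴴ * (siteExcess - ρ siteExcess • 1))).re) =
      (prodState ρ L (diagonal fun σ => (((g σ - (ρ siteExcess).re) ^ 2 : ℝ) : ℂ))).re := by
    have e : (diagonal fun σ => (((g σ - (ρ siteExcess).re) ^ 2 : ℝ) : ℂ)) =
        (mean d L siteExcess - ρ siteExcess • 1)ᴴ * (mean d L siteExcess - ρ siteExcess • 1) := by
      rw [hdiag, diagonal_conjTranspose, diagonal_mul_diagonal]
      congr 1
      funext σ
      rw [Pi.star_apply, Complex.star_def, Complex.conj_ofReal, ← Complex.ofReal_mul, sq]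
    rw [e, hvar, ← Complex.re_ofReal_mul]
    simp
  have hsq : (diagonal fun σ => Complex.exp (Complex.I * (t * (2 * (mu - lam) - gam * g σ) : ℝ)) - w)ᴴ *
      (diagonal fun σ => Complex.exp (Complex.I * (t * (2 * (mu - lam) - gam * g σ) : ℝ)) - w) =
      diagonal fun σ =>
        ((‖Complex.exp (Complex.I * (t * (2 * (mu - lam) - gam * g σ) : ℝ)) - w‖ ^ 2 : ℝ) : ℂ) := by
    rw [diagonal_conjTranspose, diagonal_mul_diagonal]
    congr 1
    funext σ
    rw [Pi.star_apply, Complex.star_def, Complex.conj_mul', Complex.ofReal_pow]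
  rw [hexp, hsq, hre]
  have hmono := (isState_prodState (L := L) (d := d) hρ).map_diagonal_mono
    (f := fun σ => ‖Complex.exp (Complex.I * (t * (2 * (mu - lam) - gam * g σ) : ℝ)) - w‖ ^ 2)
    (g := fun σ => t ^ 2 * gam ^ 2 * (g σ - (ρ siteExcess).re) ^ 2) (fun σ => by
      rw [hw]
      refine (exp_I_mul_sub_norm_sq_le _ _ _).trans (le_of_eq ?_)
      rw [phaseVelocity]
      ring)
  refine hmono.trans (le_of_eq ?_)
  have : (diagonal fun σ => ((t ^ 2 * gam ^ 2 * (g σ - (ρ siteExcess).re) ^ 2 : ℝ) : ℂ)) =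
      ((t ^ 2 * gam ^ 2 : ℝ) : ℂ) •
        diagonal fun σ => (((g σ - (ρ siteExcess).re) ^ 2 : ℝ) : ℂ) := by
    rw [← diagonal_smul]
    congr 1
    funext σ
    simp
  rw [this, map_smul, smul_eq_mul, Complex.re_ofReal_mul, mul_assoc]

/-- The mean pair field has small fluctuations around the Cooper field, at all times. -/
theorem exists_fluctuation_le (d : ℕ) (mu h lam gam T : ℝ) {ρ : SiteOp →ₗ[ℂ] ℂ} (hρ : IsState ρ) :
    ∃ K : ℝ, ∀ (L : ℕ) (t : ℝ), |t| ≤ T →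
      (evolvedState d L mu h lam gam ρ t ((mean d L pair - field mu lam gam ρ t • 1)ᴴ *
        (mean d L pair - field mu lam gam ρ t • 1))).re ≤ K * ((box d L).card : ℝ)⁻¹ := by
  set V₁ := (ρ ((pair - ρ pair • 1)ᴴ * (pair - ρ pair • 1))).re with hV₁
  set V₂ := (ρ ((siteExcess - ρ siteExcess • 1)ᴴ * (siteExcess - ρ siteExcess • 1))).re with hV₂
  have hV₂' : 0 ≤ V₂ := (Complex.nonneg_iff.mp (hρ.nonneg _)).1
  -- `V₁` accounts for the fluctuation of the pair field, `V₂` for that of its phase; the factors 2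
  -- come from `re_add_le`.
  refine ⟨2 * V₁ + 2 * (‖ρ pair‖ ^ 2 * (T ^ 2 * (gam ^ 2 * V₂))), fun L t ht => ?_⟩
  set w := Complex.exp (Complex.I * (t * phaseVelocity mu lam gam ρ : ℝ)) with hw
  set W := NormedSpace.exp ((Complex.I * (t : ℂ)) • freq d L mu lam gam) with hW
  set H := hamiltonian d L mu h lam gam
  have hH : H.IsHermitian := isHermitian_hamiltonian mu h lam gam
  have hfreq : (freq d L mu lam gam).IsHermitian := by
    have e : siteExcessᴴ = siteExcess := by
      rw [siteExcess_eq, diagonal_conjTranspose]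
      congr 1
      funext i
      simp
    rw [IsHermitian, freq, conjTranspose_sub, conjTranspose_smul, conjTranspose_smul,
      mean_conjTranspose, e]
    simp
  have hWW : Wᴴ * W = 1 := by rw [hW, exp_I_smul_conjTranspose hfreq, exp_neg_mul_exp]
  -- In the first summand the unitary `W` stands on the left and drops out of the square; the second
  -- is the phase error.
  have hev : heisenberg H t (mean d L pair - field mu lam gam ρ t • 1) =
      W * (mean d L pair - ρ pair • 1) + ρ pair • (W - w • 1) := by
    rw [map_sub, map_smul, heisenberg_one, heisenberg_mean_pair, field, mul_sub, mul_smul_comm,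
      mul_one, smul_sub, smul_smul, mul_comm w]
    abel
  rw [evolvedState, LinearMap.comp_apply, heisenberg_mul, heisenberg_conjTranspose hH, hev]
  refine ((isState_prodState hρ).re_add_le _ _).trans ?_
  have h1 : (prodState ρ L ((W * (mean d L pair - ρ pair • 1))ᴴ *
      (W * (mean d L pair - ρ pair • 1)))).re = ((box d L).card : ℝ)⁻¹ * V₁ := by
    rw [conjTranspose_mul, mul_assoc, ← mul_assoc _ W, hWW, one_mul, prodState_variance hρ, hV₁,
      ← Complex.re_ofReal_mul]
    simp
  have h2 : (prodState ρ L ((ρ pair • (W - w • 1))ᴴ * (ρ pair • (W - w • 1)))).re =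
      ‖ρ pair‖ ^ 2 * (prodState ρ L ((W - w • 1)ᴴ * (W - w • 1))).re := by
    rw [conjTranspose_smul, smul_mul_smul_comm, map_smul, smul_eq_mul, Complex.star_def,
      Complex.conj_mul', ← Complex.ofReal_pow, Complex.re_ofReal_mul]
  have h3 := prodState_exp_freq_sub (d := d) (L := L) hρ w hw
  rw [h1, h2]
  have h4 : t ^ 2 ≤ T ^ 2 := by rw [← sq_abs]; gcongr
  have h5 : t ^ 2 * (gam ^ 2 * (((box d L).card : ℝ)⁻¹ * V₂)) ≤
      T ^ 2 * (gam ^ 2 * (((box d L).card : ℝ)⁻¹ * V₂)) := by gcongr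
  have h6 := mul_le_mul_of_nonneg_left (h3.trans h5) (sq_nonneg ‖ρ pair‖)
  nlinarith [h6]

/-! ### Elementary tensors, inclusions of boxes and local commutators. -/

theorem single_eq_siteTensor {d L : ℕ} (σ τ : box d L → Fin 4) :
    single σ τ (1 : ℂ) = siteTensor fun x => single (σ x) (τ x) 1 := by
  classical
  ext σ' τ'
  simp only [siteTensor, of_apply, single_apply]
  rw [Finset.prod_ite_zero]
  simp [funext_iff, forall_and]

theorem matrix_eq_sum_smul_single {ι : Type*} [Fintype ι] [DecidableEq ι] (A : Matrix ι ι ℂ) :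
    A = ∑ i, ∑ j, A i j • single i j (1 : ℂ) := by
  conv_lhs => rw [matrix_eq_sum_single A]
  simp

/-- Matrix units are elementary tensors, so these span; linear identities for `incl` can then be
checked site by site. -/
theorem siteTensor_induction {d L : ℕ} {p : BoxOp d L → Prop}
    (hadd : ∀ A B, p A → p B → p (A + B)) (hsmul : ∀ (c : ℂ) A, p A → p (c • A))
    (h : ∀ B, p (siteTensor B)) (A : BoxOp d L) : p A := by
  have h0 : p 0 := by simpa using hsmul 0 _ (h fun _ => 1)
  rw [matrix_eq_sum_smul_single A]
  refine Finset.sum_induction _ p hadd h0 fun σ _ => Finset.sum_induction _ p hadd h0 fun τ _ => ?_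
  rw [single_eq_siteTensor]
  exact hsmul _ _ (h _)

section incl

variable {d L₀ L : ℕ}

theorem incl_add (A B : BoxOp d L₀) : incl L₀ L (A + B) = incl L₀ L A + incl L₀ L B := by
  unfold incl
  split_ifs
  · ext σ τ
    simp only [of_apply, Matrix.add_apply]
    split_ifs <;> simp
  · simp

theorem incl_smul (c : ℂ) (A : BoxOp d L₀) : incl L₀ L (c • A) = c • incl L₀ L A := by
  unfold incl
  split_ifs
  · ext σ τ
    simp only [of_apply, Matrix.smul_apply]
    split_ifs <;> simp
  · simp

/-- The inclusion of the operators of a smaller box, as a linear map. -/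
noncomputable def inclLin (d L₀ L : ℕ) : BoxOp d L₀ →ₗ[ℂ] BoxOp d L where
  toFun := incl L₀ L
  map_add' := incl_add
  map_smul' := incl_smul

theorem inclLin_apply (A : BoxOp d L₀) : inclLin d L₀ L A = incl L₀ L A := rfl

variable (h : L₀ ≤ L)
include h

-- The indicator in `incl` is the product of the Kronecker deltas of the identities at the outer
-- sites.
open scoped Classical in
theorem inclLin_siteTensor (B : box d L₀ → SiteOp) :
    inclLin d L₀ L (siteTensor B) =
      siteTensor fun y => if hy : y.1 ∈ box d L₀ then B ⟨y.1, hy⟩ else 1 := by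
  rw [inclLin_apply]
  ext σ τ
  simp only [incl, dif_pos h, of_apply, siteTensor]
  have hin : ∏ y : {y : box d L // y.1 ∈ box d L₀}, (if hy : y.1.1 ∈ box d L₀ then
      B ⟨y.1.1, hy⟩ else 1) (σ y.1) (τ y.1) =
      ∏ x : box d L₀, B x (σ ⟨x.1, box_mono h x.2⟩) (τ ⟨x.1, box_mono h x.2⟩) := by
    let e : {y : box d L // y.1 ∈ box d L₀} ≃ box d L₀ :=
      { toFun := fun y => ⟨y.1.1, y.2⟩
        invFun := fun x => ⟨⟨x.1, box_mono h x.2⟩, x.2⟩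
        left_inv := fun y => rfl
        right_inv := fun x => rfl }
    refine Fintype.prod_equiv e _ _ fun y => ?_
    rw [dif_pos y.2]
    rfl
  rw [← Fintype.prod_subtype_mul_prod_subtype (fun y : box d L => y.1 ∈ box d L₀), hin]
  have hout : ∏ y : {y : box d L // y.1 ∉ box d L₀}, (if hy : y.1.1 ∈ box d L₀ then
      B ⟨y.1.1, hy⟩ else 1) (σ y.1) (τ y.1) =
      if ∀ y : box d L, y.1 ∉ box d L₀ → σ y = τ y then 1 else 0 := by
    have : ∀ y : {y : box d L // y.1 ∉ box d L₀}, (if hy : y.1.1 ∈ box d L₀ then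
        B ⟨y.1.1, hy⟩ else 1) (σ y.1) (τ y.1) = if σ y.1 = τ y.1 then 1 else 0 := fun y => by
      rw [dif_neg y.2, Matrix.one_apply]
    rw [Finset.prod_congr rfl fun y _ => this y, Finset.prod_ite_zero]
    simp
  rw [hout, mul_ite, mul_one, mul_zero]

theorem inclLin_mul (A B : BoxOp d L₀) :
    inclLin d L₀ L (A * B) = inclLin d L₀ L A * inclLin d L₀ L B := by
  classical
  induction A using siteTensor_induction with
  | hadd A A' h1 h2 => rw [add_mul, map_add, map_add, h1, h2, add_mul]
  | hsmul c A h1 => rw [smul_mul_assoc, map_smul, map_smul, h1, smul_mul_assoc]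
  | h U =>
    induction B using siteTensor_induction with
    | hadd A A' h1 h2 => rw [mul_add, map_add, map_add, h1, h2, mul_add]
    | hsmul c A h1 => rw [mul_smul_comm, map_smul, map_smul, h1, mul_smul_comm]
    | h V =>
      rw [siteTensor_mul, inclLin_siteTensor h, inclLin_siteTensor h, inclLin_siteTensor h,
        siteTensor_mul]
      congr 1
      funext y
      split_ifs <;> simp

theorem inclLin_conjTranspose (A : BoxOp d L₀) :
    inclLin d L₀ L Aᴴ = (inclLin d L₀ L A)ᴴ := by
  classical
  induction A using siteTensor_induction with
  | hadd A A' h1 h2 => rw [conjTranspose_add, map_add, map_add, h1, h2, conjTranspose_add]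
  | hsmul c A h1 => rw [conjTranspose_smul, map_smul, map_smul, h1, conjTranspose_smul]
  | h U =>
    rw [siteTensor_conjTranspose, inclLin_siteTensor h, inclLin_siteTensor h,
      siteTensor_conjTranspose]
    congr 1
    funext y
    split_ifs <;> simp

theorem inclLin_siteEmb (x : box d L₀) (u : SiteOp) :
    inclLin d L₀ L (siteEmb x u) = siteEmb ⟨x.1, box_mono h x.2⟩ u := by
  classical
  rw [siteEmb, inclLin_siteTensor h, siteEmb]
  congr 1
  funext y
  by_cases hy : y.1 ∈ box d L₀
  · rw [dif_pos hy]
    simp only [Subtype.ext_iff]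
  · rw [dif_neg hy, if_neg]
    rintro rfl
    exact hy x.2

theorem siteEmb_commute_inclLin {y : box d L} (hy : y.1 ∉ box d L₀) (u : SiteOp)
    (A : BoxOp d L₀) : Commute (siteEmb y u) (inclLin d L₀ L A) := by
  classical
  induction A using siteTensor_induction with
  | hadd A A' h1 h2 => rw [map_add]; exact h1.add_right h2
  | hsmul c A h1 => rw [map_smul]; exact h1.smul_right c
  | h U =>
    rw [Commute, SemiconjBy, inclLin_siteTensor h, siteEmb, siteTensor_mul, siteTensor_mul]
    congr 1
    funext z
    by_cases hz : z = y
    · subst hz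
      simp [hy]
    · simp [hz]

/-- The outer sites commute with `A`, so the commutator is local and comes from an operator on the
small box not depending on `L`. -/
theorem total_inclLin_lie (u : SiteOp) (A : BoxOp d L₀) :
    total d L u * inclLin d L₀ L A - inclLin d L₀ L A * total d L u =
      inclLin d L₀ L (total d L₀ u * A - A * total d L₀ u) := by
  classical
  rw [map_sub, inclLin_mul h, inclLin_mul h]
  have hin : ∑ y : {y : box d L // y.1 ∈ box d L₀}, siteEmb y.1 u =
      inclLin d L₀ L (total d L₀ u) := by
    rw [total, map_sum]
    let e : {y : box d L // y.1 ∈ box d L₀} ≃ box d L₀ :=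
      { toFun := fun y => ⟨y.1.1, y.2⟩
        invFun := fun x => ⟨⟨x.1, box_mono h x.2⟩, x.2⟩
        left_inv := fun y => rfl
        right_inv := fun x => rfl }
    exact Fintype.sum_equiv e _ _ fun y => (inclLin_siteEmb h (e y) u).symm
  have hout : Commute (∑ y : {y : box d L // y.1 ∉ box d L₀}, siteEmb y.1 u)
      (inclLin d L₀ L A) :=
    Commute.sum_left _ _ _ fun y _ => siteEmb_commute_inclLin h y.2 u A
  have hsum : total d L u = inclLin d L₀ L (total d L₀ u) +
      ∑ y : {y : box d L // y.1 ∉ box d L₀}, siteEmb y.1 u := by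
    rw [total, ← Fintype.sum_subtype_add_sum_subtype (fun y : box d L => y.1 ∈ box d L₀), hin]
  rw [hsum, add_mul, mul_add, hout.eq]
  abel

/-- Leibniz rule for the pairing term. The factor `1/|Λ|` is attached to the pair sum outside the
commutator, so that only means multiply the local terms. -/
theorem hamiltonian_inclLin_lie (mu hz lam gam : ℝ) (A : BoxOp d L₀) :
    hamiltonian d L mu hz lam gam * inclLin d L₀ L A -
        inclLin d L₀ L A * hamiltonian d L mu hz lam gam =
      inclLin d L₀ L (total d L₀ (siteHam mu hz lam) * A - A * total d L₀ (siteHam mu hz lam)) -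
      (gam : ℂ) • ((mean d L pair)ᴴ *
          inclLin d L₀ L (total d L₀ pair * A - A * total d L₀ pair) +
        inclLin d L₀ L (total d L₀ pairᴴ * A - A * total d L₀ pairᴴ) * mean d L pair) := by
  rw [← total_inclLin_lie h, ← total_inclLin_lie h, ← total_inclLin_lie h, mean_conjTranspose,
    hamiltonian_eq]
  have h1 : mean d L pairᴴ * (inclLin d L₀ L A * total d L pair) =
      total d L pairᴴ * inclLin d L₀ L A * mean d L pair := by
    simp only [mean, smul_mul_assoc, mul_smul_comm, mul_assoc]
  have h2 : mean d L pairᴴ * (total d L pair * inclLin d L₀ L A) =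
      total d L pairᴴ * mean d L pair * inclLin d L₀ L A := by
    rw [total_mul_mean, mul_assoc]
  rw [mul_sub (mean d L pairᴴ), h1, h2]
  simp only [sub_mul, mul_sub, smul_mul_assoc, mul_smul_comm, smul_add, smul_sub, mul_assoc]
  abel

end incl

/-! ### Functionals as coordinate vectors, and approximate solutions of ODEs. -/

/-- The commutator with `B`. -/
noncomputable def lieLin {ι : Type*} [Fintype ι] (B : Matrix ι ι ℂ) :
    Matrix ι ι ℂ →ₗ[ℂ] Matrix ι ι ℂ where
  toFun A := B * A - A * B
  map_add' A A' := by rw [mul_add, add_mul]; abel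
  map_smul' c A := by rw [mul_smul_comm, smul_mul_assoc, ← smul_sub, RingHom.id_apply]

/-- The linear functional with given values on the matrix units. -/
noncomputable def functionalOfCoords {ι : Type*} [Fintype ι] (y : ι × ι → ℂ) :
    Matrix ι ι ℂ →ₗ[ℂ] ℂ where
  toFun A := ∑ i, ∑ j, A i j * y (i, j)
  map_add' A A' := by simp only [Matrix.add_apply, add_mul, Finset.sum_add_distrib]
  map_smul' c A := by
    simp only [Matrix.smul_apply, smul_eq_mul, mul_assoc, Finset.mul_sum, RingHom.id_apply]

/-- The values of a functional on the matrix units. -/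
noncomputable def coords {ι : Type*} [DecidableEq ι] (φ : Matrix ι ι ℂ →ₗ[ℂ] ℂ) : ι × ι → ℂ :=
  fun p => φ (single p.1 p.2 1)

theorem functionalOfCoords_coords {ι : Type*} [Fintype ι] [DecidableEq ι]
    (φ : Matrix ι ι ℂ →ₗ[ℂ] ℂ) (A : Matrix ι ι ℂ) : functionalOfCoords (coords φ) A = φ A := by
  conv_rhs => rw [matrix_eq_sum_smul_single A]
  simp only [map_sum, map_smul, smul_eq_mul]
  rfl

/-- Precomposition with `D` in coordinates. -/
noncomputable def precompCoords {ι : Type*} [Fintype ι] [DecidableEq ι] :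
    (Matrix ι ι ℂ →ₗ[ℂ] Matrix ι ι ℂ) →ₗ[ℂ] (ι × ι → ℂ) →L[ℂ] (ι × ι → ℂ) where
  toFun D := LinearMap.toContinuousLinearMap
    { toFun := fun y => coords (functionalOfCoords y ∘ₗ D)
      map_add' := fun y y' => by
        funext p
        simp [coords, functionalOfCoords, mul_add, Finset.sum_add_distrib]
      map_smul' := fun c y => by
        funext p
        simp [coords, functionalOfCoords, Finset.mul_sum, mul_left_comm] }
  map_add' D D' := by
    ext1 y
    funext p
    exact map_add (functionalOfCoords y) _ _
  map_smul' c D := by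
    ext1 y
    funext p
    exact map_smul (functionalOfCoords y) _ _

theorem precompCoords_coords {ι : Type*} [Fintype ι] [DecidableEq ι]
    (D : Matrix ι ι ℂ →ₗ[ℂ] Matrix ι ι ℂ) (φ : Matrix ι ι ℂ →ₗ[ℂ] ℂ) (p : ι × ι) :
    precompCoords D (coords φ) p = φ (D (single p.1 p.2 1)) := by
  change functionalOfCoords (coords φ) (D (single p.1 p.2 1)) = _
  rw [functionalOfCoords_coords]

/-- A sequence of approximate solutions of an ODE with a common initial value converges if the
errors tend to zero. -/
theorem exists_tendsto_of_approx_trajectories {E : Type*} [NormedAddCommGroup E]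
    [NormedSpace ℝ E] [CompleteSpace E] {v : ℝ → E → E} {K : NNReal} (hv : ∀ s, LipschitzWith K (v s))
    {f f' : ℕ → ℝ → E} {ε : ℕ → ℝ} (n₀ : ℕ) (y₀ : E)
    (hf : ∀ n, n₀ ≤ n → ∀ s, HasDerivAt (f n) (f' n s) s)
    (hε : ∀ n, n₀ ≤ n → ∀ s ∈ Set.Ico (0 : ℝ) 1, ‖f' n s - v s (f n s)‖ ≤ ε n)
    (h0 : ∀ n, n₀ ≤ n → f n 0 = y₀) (hlim : Filter.Tendsto ε Filter.atTop (nhds 0)) :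
    ∃ l, Filter.Tendsto (fun n => f n 1) Filter.atTop (nhds l) := by
  -- Two trajectories are compared with each other, so no exact solution is needed. With equal
  -- initial values the Grönwall bound vanishes with the errors.
  refine cauchySeq_tendsto_of_complete ?_
  rw [Metric.cauchySeq_iff]
  intro δ hδ
  have hcont : Filter.Tendsto (fun p : ℕ × ℕ => gronwallBound 0 K (ε p.1 + ε p.2) 1)
      (Filter.atTop ×ˢ Filter.atTop) (nhds 0) := by
    have h1 : Filter.Tendsto (fun p : ℕ × ℕ => ε p.1 + ε p.2)
        (Filter.atTop ×ˢ Filter.atTop) (nhds 0) := by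
      simpa using (hlim.comp Filter.tendsto_fst).add (hlim.comp Filter.tendsto_snd)
    have h2 := (gronwallBound_continuous_ε 0 K 1).tendsto 0
    rw [gronwallBound_ε0_δ0] at h2
    exact h2.comp h1
  rw [Filter.prod_atTop_atTop_eq] at hcont
  obtain ⟨⟨N₁, N₂⟩, hN⟩ := Filter.eventually_atTop.mp (hcont.eventually (gt_mem_nhds hδ))
  refine ⟨max n₀ (max N₁ N₂), fun m hm n hn => ?_⟩
  have hm0 : n₀ ≤ m := (le_max_left _ _).trans hm
  have hn0 : n₀ ≤ n := (le_max_left _ _).trans hn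
  refine lt_of_le_of_lt ?_ (hN (m, n) ⟨((le_max_left _ _).trans (le_max_right _ _)).trans hm,
    ((le_max_right _ _).trans (le_max_right _ _)).trans hn⟩)
  have := dist_le_of_approx_trajectories_ODE (a := 0) (b := 1) (δ := 0) hv
    (fun s _ => (hf m hm0 s).continuousAt.continuousWithinAt)
    (fun s _ => (hf m hm0 s).hasDerivWithinAt)
    (fun s hs => by rw [dist_eq_norm]; exact hε m hm0 s hs)
    (fun s _ => (hf n hn0 s).continuousAt.continuousWithinAt)
    (fun s _ => (hf n hn0 s).hasDerivWithinAt)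
    (fun s hs => by rw [dist_eq_norm]; exact hε n hn0 s hs)
    (by rw [h0 m hm0, h0 n hn0, dist_self]) 1 (by simp)
  simpa using this

/-! ### Effective dynamics and existence of the thermodynamic limit. -/

/-- Cauchy-Schwarz for each matrix unit `E` of the small box: `E Eᴴ` is a projection, of expectation
at most one. The constant does not depend on `L`. -/
theorem norm_map_inclLin_mul_le {d L₀ L : ℕ} (h : L₀ ≤ L) {φ : BoxOp d L →ₗ[ℂ] ℂ}
    (hφ : IsState φ) (X : BoxOp d L₀) (Y : BoxOp d L) :
    ‖φ (inclLin d L₀ L X * Y)‖ ≤ (∑ σ, ∑ τ, ‖X σ τ‖) * √(φ (Yᴴ * Y)).re := by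
  have h1 : ∀ σ τ : box d L₀ → Fin 4,
      ‖φ (inclLin d L₀ L (single σ τ 1) * Y)‖ ≤ √(φ (Yᴴ * Y)).re := by
    intro σ τ
    have e : inclLin d L₀ L (single σ τ 1) = (inclLin d L₀ L (single τ σ 1))ᴴ := by
      rw [← inclLin_conjTranspose h, conjTranspose_single, star_one]
    rw [e]
    refine hφ.norm_le_sqrt ?_
    rw [← e, ← inclLin_mul h, single_mul_single_same, mul_one]
    refine (Complex.le_def.mp (hφ.map_projection_le_one (P := inclLin d L₀ L (single σ σ 1)) ?_ ?_)).1
    · rw [← inclLin_conjTranspose h, conjTranspose_single, star_one]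
    · rw [← inclLin_mul h, single_mul_single_same, mul_one]
  conv_lhs => rw [matrix_eq_sum_smul_single X]
  simp only [map_sum, map_smul, Finset.sum_mul, smul_mul_assoc]
  refine (norm_sum_le _ _).trans (Finset.sum_le_sum fun σ _ => (norm_sum_le _ _).trans
    (Finset.sum_le_sum fun τ _ => ?_))
  rw [norm_smul]
  gcongr
  exact h1 σ τ

/-- The generator of the effective dynamics of local observables in the Cooper field `z`. -/
noncomputable def effGen (d L₀ : ℕ) (mu h lam gam : ℝ) (z : ℂ) :
    BoxOp d L₀ →ₗ[ℂ] BoxOp d L₀ :=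
  Complex.I • (lieLin (total d L₀ (siteHam mu h lam)) -
    (gam : ℂ) • (star z • lieLin (total d L₀ pair) + z • lieLin (total d L₀ pairᴴ)))

/-- On local observables the dynamics of a large system is close to the effective one if the mean
pair field is close to `z`. -/
theorem norm_map_lie_sub_effGen_le {d L₀ L : ℕ} (hL : L₀ ≤ L) (mu h lam gam : ℝ) (z : ℂ)
    {φ : BoxOp d L →ₗ[ℂ] ℂ} (hφ : IsState φ) (A : BoxOp d L₀) :
    ‖φ (Complex.I • (hamiltonian d L mu h lam gam * inclLin d L₀ L A -
        inclLin d L₀ L A * hamiltonian d L mu h lam gam)) -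
      φ (inclLin d L₀ L (effGen d L₀ mu h lam gam z A))‖ ≤
      |gam| * ((∑ σ, ∑ τ, ‖(lieLin (total d L₀ pair) A)ᴴ σ τ‖) +
        ∑ σ, ∑ τ, ‖lieLin (total d L₀ pairᴴ) A σ τ‖) *
        √(φ ((mean d L pair - z • 1)ᴴ * (mean d L pair - z • 1))).re := by
  set X := lieLin (total d L₀ pair) A with hX
  set X' := lieLin (total d L₀ pairᴴ) A with hX'
  set Y := mean d L pair - z • 1 with hY
  -- In one term the field stands to the left of the local factor; taking the adjoint brings both
  -- terms to the form local operator times `Y`.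
  have e : Complex.I • (hamiltonian d L mu h lam gam * inclLin d L₀ L A -
        inclLin d L₀ L A * hamiltonian d L mu h lam gam) -
      inclLin d L₀ L (effGen d L₀ mu h lam gam z A) =
      (-(Complex.I * gam)) • ((inclLin d L₀ L Xᴴ * Y)ᴴ + inclLin d L₀ L X' * Y) := by
    rw [hamiltonian_inclLin_lie hL]
    have e1 : effGen d L₀ mu h lam gam z A =
        Complex.I • (lieLin (total d L₀ (siteHam mu h lam)) A -
          (gam : ℂ) • (star z • X + z • X')) := rfl
    have e2 : ∀ B : BoxOp d L₀, B * A - A * B = lieLin B A := fun _ => rfl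
    rw [e1, e2, e2, e2, ← hX, ← hX', conjTranspose_mul, inclLin_conjTranspose hL,
      conjTranspose_conjTranspose, hY, conjTranspose_sub, conjTranspose_smul, conjTranspose_one]
    simp only [map_sub, map_add, map_smul, sub_mul, mul_sub, smul_mul_assoc, mul_smul_comm,
      one_mul, mul_one]
    module
  rw [← map_sub, e, map_smul, map_add, hφ.map_conjTranspose, norm_smul, norm_neg, norm_mul,
    Complex.norm_I, one_mul, Complex.norm_real, Real.norm_eq_abs, mul_assoc]
  refine mul_le_mul_of_nonneg_left ((norm_add_le _ _).trans ?_) (abs_nonneg _)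
  rw [norm_star, add_mul]
  exact add_le_add (norm_map_inclLin_mul_le hL hφ _ _) (norm_map_inclLin_mul_le hL hφ _ _)

theorem tendsto_inv_card_box {d : ℕ} (hd : 1 ≤ d) :
    Filter.Tendsto (fun L => ((box d L).card : ℝ)⁻¹) Filter.atTop (nhds 0) := by
  refine tendsto_inv_atTop_zero.comp ?_
  refine tendsto_natCast_atTop_atTop.comp (Filter.tendsto_atTop_mono (fun L => ?_) Filter.tendsto_id)
  rw [card_box]
  calc L ≤ (2 * L + 1) ^ 1 := by rw [pow_one]; omega
    _ ≤ _ := Nat.pow_le_pow_right (by omega) hd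

/-- Product states of different boxes are consistent: the initial value of the ODE does not depend
on `L`. -/
theorem prodState_inclLin_single {d L₀ L : ℕ} (hL : L₀ ≤ L) {ρ : SiteOp →ₗ[ℂ] ℂ} (hρ : ρ 1 = 1)
    (σ τ : box d L₀ → Fin 4) :
    prodState ρ L (inclLin d L₀ L (single σ τ 1)) = ∏ x, ρ (single (σ x) (τ x) 1) := by
  classical
  rw [single_eq_siteTensor, inclLin_siteTensor hL, prodState_siteTensor,
    ← Fintype.prod_subtype_mul_prod_subtype (fun y : box d L => y.1 ∈ box d L₀)]
  have hout : ∏ y : {y : box d L // y.1 ∉ box d L₀}, ρ (if hy : y.1.1 ∈ box d L₀ then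
      single (σ ⟨y.1.1, hy⟩) (τ ⟨y.1.1, hy⟩) 1 else 1) = 1 :=
    Finset.prod_eq_one fun y _ => by rw [dif_neg y.2, hρ]
  rw [hout, mul_one]
  let e : {y : box d L // y.1 ∈ box d L₀} ≃ box d L₀ :=
    { toFun := fun y => ⟨y.1.1, y.2⟩
      invFun := fun x => ⟨⟨x.1, box_mono hL x.2⟩, x.2⟩
      left_inv := fun y => rfl
      right_inv := fun x => rfl }
  refine Fintype.prod_equiv e _ _ fun y => ?_
  rw [dif_pos y.2]
  rfl

theorem exists_norm_precompCoords_effGen_le (d L₀ : ℕ) (mu h lam gam r : ℝ) :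
    ∃ C : NNReal, ∀ z : ℂ, ‖z‖ ≤ r → ‖precompCoords (effGen d L₀ mu h lam gam z)‖₊ ≤ C := by
  set B₀ := precompCoords (lieLin (total d L₀ (siteHam mu h lam)))
  set B₁ := precompCoords (lieLin (total d L₀ pair))
  set B₂ := precompCoords (lieLin (total d L₀ pairᴴ))
  refine ⟨(‖B₀‖ + |gam| * (r * ‖B₁‖ + r * ‖B₂‖)).toNNReal, fun z hz => ?_⟩
  refine NNReal.coe_le_coe.mp (le_trans ?_ (Real.le_coe_toNNReal _))
  rw [coe_nnnorm, effGen, map_smul, map_sub, map_smul, map_add, map_smul, map_smul, norm_smul,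
    Complex.norm_I, one_mul]
  refine (norm_sub_le _ _).trans ?_
  rw [norm_smul, Complex.norm_real, Real.norm_eq_abs]
  gcongr
  refine (norm_add_le _ _).trans ?_
  rw [norm_smul, norm_smul, norm_star]
  gcongr

/-- The thermodynamic limit of the expectations of local observables exists. -/
theorem exists_tendsto_evolvedState {d : ℕ} (hd : 1 ≤ d) (mu h lam gam : ℝ) {ρ : SiteOp →ₗ[ℂ] ℂ}
    (hρ : IsState ρ) (t : ℝ) (L₀ : ℕ) (A : BoxOp d L₀) :
    ∃ l, Filter.Tendsto (fun L => evolvedState d L mu h lam gam ρ t (inclLin d L₀ L A))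
      Filter.atTop (nhds l) := by
  obtain ⟨K, hK⟩ := exists_fluctuation_le d mu h lam gam |t| hρ
  let ι := box d L₀ → Fin 4
  -- Time is rescaled to `t * s` with `s` in `[0, 1]`, which treats both signs of `t` at once and
  -- puts a factor `t` in front of the generator.
  let G : ℝ → (ι × ι → ℂ) →L[ℂ] (ι × ι → ℂ) := fun s =>
    precompCoords (effGen d L₀ mu h lam gam (field mu lam gam ρ (t * s)))
  obtain ⟨C, hC⟩ := exists_norm_precompCoords_effGen_le d L₀ mu h lam gam ‖ρ pair‖
  have hG : ∀ s, LipschitzWith (‖t‖₊ * C) fun y => t • G s y := fun s =>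
    (lipschitzWith_smul t).comp ((G s).lipschitz.weaken (hC _ (norm_field mu lam gam ρ _).le))
  let c : ι × ι → ℝ := fun p =>
    |gam| * ((∑ σ, ∑ τ, ‖(lieLin (total d L₀ pair) (single p.1 p.2 1))ᴴ σ τ‖) +
      ∑ σ, ∑ τ, ‖lieLin (total d L₀ pairᴴ) (single p.1 p.2 1) σ τ‖)
  have hc : ∀ p, 0 ≤ c p := fun p => by positivity
  let φ : ℕ → ℝ → BoxOp d L₀ →ₗ[ℂ] ℂ := fun L s =>
    evolvedState d L mu h lam gam ρ (t * s) ∘ₗ inclLin d L₀ L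
  obtain ⟨l, hl⟩ : ∃ l, Filter.Tendsto (fun L => coords (φ L 1)) Filter.atTop (nhds l) := by
    refine exists_tendsto_of_approx_trajectories hG
      (f := fun L s => coords (φ L s))
      (f' := fun L s p => t • evolvedState d L mu h lam gam ρ (t * s)
        (Complex.I • (hamiltonian d L mu h lam gam * inclLin d L₀ L (single p.1 p.2 1) -
          inclLin d L₀ L (single p.1 p.2 1) * hamiltonian d L mu h lam gam)))
      -- The sup norm over the coordinates is bounded through `∑ p, c p`, and the variance bound of
      -- order `1/|Λ|` enters under the root.
      (ε := fun L => |t| * ((∑ p, c p) * √(K * ((box d L).card : ℝ)⁻¹))) L₀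
      (fun p => ∏ x, ρ (single (p.1 x) (p.2 x) 1)) ?_ ?_ ?_ ?_
    · intro L hL s
      refine hasDerivAt_pi.mpr fun p => ?_
      have h1 := hasDerivAt_heisenberg_apply (hamiltonian d L mu h lam gam) (prodState ρ L)
        (inclLin d L₀ L (single p.1 p.2 1)) (t * s)
      exact h1.scomp s (by simpa using! (hasDerivAt_id s).const_mul t)
    · intro L hL s hs
      have hts : |t * s| ≤ |t| := by
        rw [abs_mul, abs_of_nonneg hs.1]
        exact mul_le_of_le_one_right (abs_nonneg t) hs.2.le
      refine (pi_norm_le_iff_of_nonneg (by positivity)).mpr fun p => ?_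
      have h1 := norm_map_lie_sub_effGen_le hL mu h lam gam (field mu lam gam ρ (t * s))
        (isState_evolvedState (d := d) (L := L) (mu := mu) (h := h) (lam := lam) (gam := gam)
          (t := t * s) hρ) (single p.1 p.2 1)
      rw [Pi.sub_apply, Pi.smul_apply, precompCoords_coords, ← smul_sub, norm_smul,
        Real.norm_eq_abs]
      refine mul_le_mul_of_nonneg_left (h1.trans ?_) (abs_nonneg t)
      exact mul_le_mul (Finset.single_le_sum (f := c) (fun p _ => hc p) (Finset.mem_univ p))
        (Real.sqrt_le_sqrt (hK L _ hts)) (Real.sqrt_nonneg _) (Finset.sum_nonneg fun p _ => hc p)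
    · intro L hL
      funext p
      simp only [coords, φ, LinearMap.comp_apply, evolvedState, mul_zero, heisenberg_zero]
      exact prodState_inclLin_single hL hρ.map_one p.1 p.2
    · have h1 := (((tendsto_inv_card_box hd).const_mul K).sqrt.const_mul (∑ p, c p)).const_mul |t|
      simpa using h1
  refine ⟨functionalOfCoords l A, ?_⟩
  have h1 : ∀ L, evolvedState d L mu h lam gam ρ t (inclLin d L₀ L A) =
      functionalOfCoords (coords (φ L 1)) A := fun L => by
    rw [functionalOfCoords_coords]
    simp only [φ, mul_one, LinearMap.comp_apply]
  simp only [h1]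
  exact tendsto_finsetSum _ fun σ _ => tendsto_finsetSum _ fun τ _ =>
    (tendsto_pi_nhds.mp hl (σ, τ)).const_mul _

/-! ### Limit of the Cooper field, and ranges of the one-site expectations. -/

/-- Convergence in mean square implies convergence of expectations, by `|φ(Y)|² ≤ φ(Yᴴ Y)`. -/
theorem tendsto_evolvedState_mean_pair {d : ℕ} (hd : 1 ≤ d) (mu h lam gam : ℝ)
    {ρ : SiteOp →ₗ[ℂ] ℂ} (hρ : IsState ρ) (t : ℝ) :
    Filter.Tendsto (fun L => evolvedState d L mu h lam gam ρ t (mean d L pair))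
      Filter.atTop (nhds (field mu lam gam ρ t)) := by
  obtain ⟨K, hK⟩ := exists_fluctuation_le d mu h lam gam |t| hρ
  rw [tendsto_iff_norm_sub_tendsto_zero]
  refine squeeze_zero (g := fun L => √(K * ((box d L).card : ℝ)⁻¹)) (fun _ => norm_nonneg _)
    (fun L => ?_) ?_
  · have hφ := isState_evolvedState (d := d) (L := L) (mu := mu) (h := h) (lam := lam) (gam := gam)
      (t := t) hρ
    have h1 := hφ.norm_map_le_sqrt (mean d L pair - field mu lam gam ρ t • 1)
    rw [map_sub, map_smul, hφ.map_one, smul_eq_mul, mul_one] at h1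
    exact h1.trans (Real.sqrt_le_sqrt (hK L t le_rfl))
  · simpa using ((tendsto_inv_card_box hd).const_mul K).sqrt

theorem exists_coe_of_isState_diagonal {ρ : SiteOp →ₗ[ℂ] ℂ} (hρ : IsState ρ) {f : Fin 4 → ℂ}
    (h : ∀ i, f i = 0 ∨ f i = 1) :
    ∃ r ∈ Set.Icc (0 : ℝ) 1, ρ (diagonal f) = (r : ℂ) := by
  have h1 : (diagonal f)ᴴ = diagonal f := by
    rw [diagonal_conjTranspose]
    congr 1
    funext i
    rcases h i with hi | hi <;> simp [hi]
  have h2 : diagonal f * diagonal f = diagonal f := by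
    rw [diagonal_mul_diagonal]
    congr 1
    funext i
    rcases h i with hi | hi <;> simp [hi]
  have h3 := Complex.le_def.mp (hρ.map_projection_nonneg h1 h2)
  have h4 := Complex.le_def.mp (hρ.map_projection_le_one h1 h2)
  refine ⟨(ρ (diagonal f)).re, ⟨h3.1, h4.1⟩, Complex.ext rfl ?_⟩
  rw [Complex.ofReal_im, ← h3.2, Complex.zero_im]

theorem norm_map_pair_le_one {ρ : SiteOp →ₗ[ℂ] ℂ} (hρ : IsState ρ) : ‖ρ pair‖ ≤ 1 := by
  refine (hρ.norm_map_le_sqrt pair).trans (Real.sqrt_le_one.mpr ?_)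
  refine (Complex.le_def.mp (hρ.map_projection_le_one (P := pairᴴ * pair) ?_ ?_)).1
  · rw [conjTranspose_mul, conjTranspose_conjTranspose]
  · rw [pair_eq, conjTranspose_single, single_mul_single_same, single_mul_single_same]
    simp

theorem exists_polar (z : ℂ) (hz : ‖z‖ ≤ 1) :
    ∃ κ ∈ Set.Icc (0 : ℝ) 1, ∃ θ ∈ Set.Ico (-Real.pi) Real.pi,
      z = (√κ : ℂ) * Complex.exp (Complex.I * (θ : ℂ)) := by
  have hκ : √(‖z‖ ^ 2) = ‖z‖ := Real.sqrt_sq (norm_nonneg z)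
  refine ⟨‖z‖ ^ 2, ⟨by positivity, pow_le_one₀ (norm_nonneg z) hz⟩, ?_⟩
  rw [hκ]
  rcases (Complex.arg_le_pi z).lt_or_eq with h | h
  · refine ⟨z.arg, ⟨(Complex.neg_pi_lt_arg z).le, h⟩, ?_⟩
    rw [mul_comm Complex.I, Complex.norm_mul_exp_arg_mul_I]
  -- `Complex.arg` takes values in `(-π, π]`, so the value `π` has to be moved to `-π`.
  · refine ⟨-Real.pi, ⟨le_rfl, by linarith [Real.pi_pos]⟩, ?_⟩
    have := Complex.norm_mul_exp_arg_mul_I z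
    rw [h, Complex.exp_pi_mul_I] at this
    rw [Complex.ofReal_neg, mul_neg, mul_comm, Complex.exp_neg, mul_comm Complex.I,
      Complex.exp_pi_mul_I]
    rw [← this]
    simp [mul_comm]

end BCSHubbard

/-! ### The conserved densities and the rotating Cooper field. -/

open BCSHubbard in
theorem proposition1 (d : ℕ) (hd : 1 ≤ d) (mu h lam gam : ℝ) (hlam : 0 ≤ lam) (hgam : 0 ≤ gam)
    (ρ : BCSHubbard.SiteOp →ₗ[ℂ] ℂ) (hρ : BCSHubbard.IsSiteState ρ)
    (hρ_even : BCSHubbard.IsEvenFunctional ρ) :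
    ∃ (ρt : ℝ → (L₀ : ℕ) → BCSHubbard.BoxOp d L₀ → ℂ) (dens magn coul : ℝ),
      -- the thermodynamic limit `ρt t` exists on all local observables
      (∀ (t : ℝ) (L₀ : ℕ) (A : BCSHubbard.BoxOp d L₀),
        Filter.Tendsto
          (fun L : ℕ => BCSHubbard.productState ρ L
            (BCSHubbard.evolve mu h lam gam t (BCSHubbard.incl L₀ L A)))
          Filter.atTop (nhds (ρt t L₀ A))) ∧
      -- (i) electron density
      (dens ∈ Set.Icc (0 : ℝ) 2 ∧
        ρ (BCSHubbard.siteNum BCSHubbard.Spin.up + BCSHubbard.siteNum BCSHubbard.Spin.down)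
          = (dens : ℂ) ∧
        ∀ t : ℝ, ρt t 0 (BCSHubbard.num (BCSHubbard.origin d 0) BCSHubbard.Spin.up
          + BCSHubbard.num (BCSHubbard.origin d 0) BCSHubbard.Spin.down) = (dens : ℂ)) ∧
      -- (ii) magnetization density
      (magn ∈ Set.Icc (-1 : ℝ) 1 ∧
        ρ (BCSHubbard.siteNum BCSHubbard.Spin.up - BCSHubbard.siteNum BCSHubbard.Spin.down)
          = (magn : ℂ) ∧
        ∀ t : ℝ, ρt t 0 (BCSHubbard.num (BCSHubbard.origin d 0) BCSHubbard.Spin.up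
          - BCSHubbard.num (BCSHubbard.origin d 0) BCSHubbard.Spin.down) = (magn : ℂ)) ∧
      -- (iii) Coulomb correlation density
      (coul ∈ Set.Icc (0 : ℝ) 1 ∧
        ρ (BCSHubbard.siteNum BCSHubbard.Spin.up * BCSHubbard.siteNum BCSHubbard.Spin.down)
          = (coul : ℂ) ∧
        ∀ t : ℝ, ρt t 0 (BCSHubbard.num (BCSHubbard.origin d 0) BCSHubbard.Spin.up
          * BCSHubbard.num (BCSHubbard.origin d 0) BCSHubbard.Spin.down) = (coul : ℂ)) ∧
      -- (iv) Cooper field: `κ` and `θ` exist, and any choice of them describes the evolution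
      (∃ κ ∈ Set.Icc (0 : ℝ) 1, ∃ θ ∈ Set.Ico (-Real.pi) Real.pi,
        ρ (BCSHubbard.siteAnn BCSHubbard.Spin.down * BCSHubbard.siteAnn BCSHubbard.Spin.up)
          = (Real.sqrt κ : ℂ) * Complex.exp (Complex.I * (θ : ℂ))) ∧
      (∀ κ ∈ Set.Icc (0 : ℝ) 1, ∀ θ ∈ Set.Ico (-Real.pi) Real.pi,
        ρ (BCSHubbard.siteAnn BCSHubbard.Spin.down * BCSHubbard.siteAnn BCSHubbard.Spin.up)
          = (Real.sqrt κ : ℂ) * Complex.exp (Complex.I * (θ : ℂ)) →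
        ∀ t : ℝ, ρt t 0 (BCSHubbard.ann (BCSHubbard.origin d 0) BCSHubbard.Spin.down
            * BCSHubbard.ann (BCSHubbard.origin d 0) BCSHubbard.Spin.up)
          = (Real.sqrt κ : ℂ) * Complex.exp
              (Complex.I * ((t * (2 * (mu - lam) + gam * (1 - dens)) + θ : ℝ) : ℂ))) := by

  have hs : IsState ρ := hρ.isState
  -- These limits are by definition those of the goal: `evolvedState` and `inclLin` unfold to
  -- `productState`, `evolve` and `incl`.
  choose ρt hρt using fun (t : ℝ) (L₀ : ℕ) (A : BoxOp d L₀) =>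
    exists_tendsto_evolvedState hd mu h lam gam hs t L₀ A
  obtain ⟨up, hup, hup'⟩ := exists_coe_of_isState_diagonal hs (f := ![0, 1, 0, 1])
    (by intro i; fin_cases i <;> simp)
  obtain ⟨down, hdown, hdown'⟩ := exists_coe_of_isState_diagonal hs (f := ![0, 0, 1, 1])
    (by intro i; fin_cases i <;> simp)
  obtain ⟨coul, hcoul, hcoul'⟩ := exists_coe_of_isState_diagonal hs (f := ![0, 0, 0, 1])
    (by intro i; fin_cases i <;> simp)
  have hincl : ∀ (L : ℕ) (u : SiteOp),
      inclLin d 0 L (siteEmb (origin d 0) u) = siteEmb (origin d L) u := fun L u =>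
    inclLin_siteEmb (Nat.zero_le L) _ u
  have hconst : ∀ (t : ℝ) (u : SiteOp) (f : Fin 4 → ℝ), u = Matrix.diagonal (fun i => (f i : ℂ)) →
      ρt t 0 (siteEmb (origin d 0) u) = ρ u := by
    intro t u f hu
    refine tendsto_nhds_unique (hρt t 0 _) ?_
    simp only [hincl, hu, evolvedState_siteEmb_diagonal hs.map_one]
    exact tendsto_const_nhds
  have hfield : ∀ t : ℝ, ρt t 0 (siteEmb (origin d 0) pair) = field mu lam gam ρ t := by
    intro t
    refine tendsto_nhds_unique (hρt t 0 _) ?_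
    simp only [hincl, evolvedState_siteEmb]
    exact tendsto_evolvedState_mean_pair hd mu h lam gam hs t
  rw [← siteNum_up] at hup'
  rw [← siteNum_down] at hdown'
  have hprod : siteNum Spin.up * siteNum Spin.down = Matrix.diagonal ![0, 0, 0, 1] := by
    rw [siteNum_up, siteNum_down, Matrix.diagonal_mul_diagonal]
    congr 1
    funext i
    fin_cases i <;> simp
  rw [← hprod] at hcoul'
  have hdens : ρ (siteNum Spin.up + siteNum Spin.down) = ((up + down : ℝ) : ℂ) := by
    rw [map_add, hup', hdown', Complex.ofReal_add]
  have hmagn : ρ (siteNum Spin.up - siteNum Spin.down) = ((up - down : ℝ) : ℂ) := by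
    rw [map_sub, hup', hdown', Complex.ofReal_sub]
  refine ⟨ρt, up + down, up - down, coul, hρt,
    ⟨⟨by linarith [hup.1, hdown.1], by linarith [hup.2, hdown.2]⟩, hdens, fun t => ?_⟩,
    ⟨⟨by linarith [hup.1, hdown.2], by linarith [hup.2, hdown.1]⟩, hmagn, fun t => ?_⟩,
    ⟨hcoul, hcoul', fun t => ?_⟩, exists_polar _ (norm_map_pair_le_one hs),
    fun κ _ θ _ hκθ t => ?_⟩
  -- The vector lists the eigenvalues of `n↑ + n↓` on vacuum, up, down and doubly occupied; the next
  -- two cases are analogous.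
  · rw [num_eq, num_eq, ← siteEmb_add, hconst t _ ![0, 1, 1, 2], hdens]
    rw [siteNum_up, siteNum_down, Matrix.diagonal_add]
    congr 1
    funext i
    fin_cases i <;> norm_num
  · rw [num_eq, num_eq, ← siteEmb_sub, hconst t _ ![0, 1, -1, 0], hmagn]
    rw [siteNum_up, siteNum_down, Matrix.diagonal_sub]
    congr 1
    funext i
    fin_cases i <;> norm_num
  · rw [num_eq, num_eq, siteEmb_mul, hconst t _ ![0, 0, 0, 1], hcoul']
    rw [hprod]
    congr 1
    funext i
    fin_cases i <;> norm_num
  -- The excess is the density minus one, so `-γ ρ(excess) = γ (1 - dens)`.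
  · have hv : phaseVelocity mu lam gam ρ = 2 * (mu - lam) + gam * (1 - (up + down)) := by
      rw [phaseVelocity, siteExcess, map_sub, hdens, hs.map_one, Complex.sub_re, Complex.ofReal_re,
        Complex.one_re]
      ring
    rw [ann_mul_ann, hfield, field, pair, hκθ, hv, mul_left_comm, ← Complex.exp_add, ← mul_add,
      Complex.ofReal_add _ θ]
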